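/- **Classification of finite-energy curves.** Let $q>1$ and $p\in\left(\tfrac23q+1,\;q+\tfrac23\right)$. For a $C^1$ curve $\gamma:\mathbb R/\mathbb Z\to\mathbb R^n$ let $$E^{p,q}(\gamma)=\iiint_{(\mathbb R/\mathbb Z)^3}\frac{|\gamma'(u_1)||\gamma'(u_2)||\gamma'(u_3)|}{R^{(p,q)}(\gamma(u_1),\gamma(u_2),\gamma(u_3))}\,du_1\,du_2\,du_3\in[0,\infty],\qquad R^{(p,q)}(x,y,z)=\frac{\left(|y-z||y-x||z-x|\right)^p}{|(y-x)\wedge(z-x)|^q}$$ be its generalized integral Menger curvature, where $|a\wedge b|=\sqrt{|a|^2|b|^2-\langle a,b\rangle^2}$. For $s\in(0,1)$ let $W^{1+s,q}(\mathbb R/\mathbb Z,\mathbb R^n)$ be the Sobolev–Slobodeckiĭ space of all $f\in W^{1,q}(\mathbb R/\mathbb Z,\mathbb R^n)$ whose norm $$\|f\|_{W^{1+s,q}}=\|f\|_{L^q}+\|f'\|_{L^q}+\left(\int_{\mathbb R/\mathbb Z}\int_{-1/2}^{1/2}\frac{|f'(u+w)-f'(u)|^q}{|w|^{1+qs}}\,dw\,du\right)^{1/q}$$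 is finite. Let $\sigma=\frac{3p-2}{q}-1$; then $\sigma\in(1+\tfrac1q,2)$. For every $n$ and every injective curve $\gamma\in C^1(\mathbb R/\mathbb Z,\mathbb R^n)$ parametrized by arc-length, $$E^{p,q}(\gamma)<\infty\quad\Longleftrightarrow\quad\gamma\in W^{\sigma,q}(\mathbb R/\mathbb Z,\mathbb R^n).$$ Moreover, there are constants $C,\beta>0$ depending on $p$ and $q$ only such that, for all such $n$ and $\gamma$ with $E^{p,q}(\gamma)<\infty$ and for every $u_0\in\mathbb R/\mathbb Z$, $$\|\gamma-\gamma(u_0)\|_{W^{\sigma,q}}\le C\left(E^{p,q}(\gamma)+E^{p,q}(\gamma)^{\beta}\right).$$ -/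

import Mathlib

open MeasureTheory Set
open scoped ENNReal ContDiff

noncomputable section

/-- The area `|a ∧ b|` of the parallelogram spanned by two vectors of `ℝⁿ`. -/
def wedgeNorm {n : ℕ} (a b : EuclideanSpace ℝ (Fin n)) : ℝ :=
  Real.sqrt (‖a‖ ^ 2 * ‖b‖ ^ 2 - (inner ℝ a b) ^ 2)

/-- The denominator `R^{(p,q)}(x,y,z) = (|y-z| |y-x| |z-x|)^p / |(y-x) ∧ (z-x)|^q`.
Only its reciprocal is used. The rule `a / 0 = 0` makes the reciprocal equal to
`|(y-x) ∧ (z-x)|^q / (|y-z| |y-x| |z-x|)^p` for all points; for `q > 0` it is `0`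
for distinct collinear points, as it should be (`R = ∞`). -/
def mengerR {n : ℕ} (p q : ℝ) (x y z : EuclideanSpace ℝ (Fin n)) : ℝ :=
  (‖y - z‖ * ‖y - x‖ * ‖z - x‖) ^ p / wedgeNorm (y - x) (z - x) ^ q

/-- The classical derivative of a closed curve `γ : ℝ/ℤ → ℝⁿ`. -/
def curveDeriv {n : ℕ} (γ : UnitAddCircle → EuclideanSpace ℝ (Fin n)) :
    UnitAddCircle → EuclideanSpace ℝ (Fin n) :=
  fun u => deriv (fun t : ℝ => γ (u + (t : UnitAddCircle))) 0

/-- `γ ∈ C¹(ℝ/ℤ, ℝⁿ)`. -/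
def IsC1Curve {n : ℕ} (γ : UnitAddCircle → EuclideanSpace ℝ (Fin n)) : Prop :=
  ContDiff ℝ 1 (fun t : ℝ => γ (t : UnitAddCircle))

/-- The generalized integral Menger curvature `E^{p,q}(γ) ∈ [0,∞]`. -/
def mengerEnergy {n : ℕ} (p q : ℝ) (γ : UnitAddCircle → EuclideanSpace ℝ (Fin n)) : ℝ≥0∞ :=
  ∫⁻ u₁ : UnitAddCircle, ∫⁻ u₂ : UnitAddCircle, ∫⁻ u₃ : UnitAddCircle,
    ENNReal.ofReal
      ((‖curveDeriv γ u₁‖ * ‖curveDeriv γ u₂‖ * ‖curveDeriv γ u₃‖) /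
        mengerR p q (γ u₁) (γ u₂) (γ u₃))

/-- `g` is a weak derivative of `f` on `ℝ/ℤ`: both are integrable, and their periodic extensions
to `ℝ` satisfy `∫ φ' f = -∫ φ g` for all test functions `φ ∈ C_c^∞(ℝ)`. -/
def IsWeakDeriv {n : ℕ} (f g : UnitAddCircle → EuclideanSpace ℝ (Fin n)) : Prop :=
  Integrable f ∧ Integrable g ∧
    ∀ φ : ℝ → ℝ, ContDiff ℝ ∞ φ → HasCompactSupport φ →
      ∫ t : ℝ, deriv φ t • f (t : UnitAddCircle) = -∫ t : ℝ, φ t • g (t : UnitAddCircle)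

/-- The Sobolev space `W^{1,ρ}(ℝ/ℤ, ℝⁿ)`. -/
def MemSobolevOne {n : ℕ} (ρ : ℝ) (f : UnitAddCircle → EuclideanSpace ℝ (Fin n)) : Prop :=
  MemLp f (ENNReal.ofReal ρ) ∧
    ∃ g : UnitAddCircle → EuclideanSpace ℝ (Fin n),
      IsWeakDeriv f g ∧ MemLp g (ENNReal.ofReal ρ)

/-- The Gagliardo seminorm of order `s ∈ (0,1)`,
`(∫_{ℝ/ℤ} ∫_{-1/2}^{1/2} |g(u+w) - g(u)|^ρ / |w|^{1+ρs} dw du)^{1/ρ}`. -/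
def gagliardo {n : ℕ} (s ρ : ℝ) (g : UnitAddCircle → EuclideanSpace ℝ (Fin n)) : ℝ≥0∞ :=
  (∫⁻ u : UnitAddCircle, ∫⁻ w : ℝ in Ioo (-(1 / 2)) (1 / 2),
    ENNReal.ofReal (‖g (u + (w : UnitAddCircle)) - g u‖ ^ ρ / |w| ^ (1 + ρ * s))) ^ (1 / ρ)

/-- The norm `‖f‖_{L^ρ} + ‖f'‖_{L^ρ} + [f']_{σ-1,ρ}` of the Sobolev–Slobodeckij space
`W^{σ,ρ}(ℝ/ℤ, ℝⁿ)` of order `σ ∈ (1,2)`. The infimum runs over all weak derivatives `g = f'`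
of `f`; these agree almost everywhere, so that there is at most one value. It is `∞` if there is
no weak derivative. -/
def slobodeckijNorm {n : ℕ} (σ ρ : ℝ) (f : UnitAddCircle → EuclideanSpace ℝ (Fin n)) : ℝ≥0∞ :=
  ⨅ (g : UnitAddCircle → EuclideanSpace ℝ (Fin n)) (_ : IsWeakDeriv f g),
    (eLpNorm f (ENNReal.ofReal ρ) volume + eLpNorm g (ENNReal.ofReal ρ) volume +
      gagliardo (σ - 1) ρ g)

/-- `f ∈ W^{σ,ρ}(ℝ/ℤ, ℝⁿ)`, for `σ ∈ (1,2)`. -/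
def MemSlobodeckij {n : ℕ} (σ ρ : ℝ) (f : UnitAddCircle → EuclideanSpace ℝ (Fin n)) : Prop :=
  MemSobolevOne ρ f ∧ slobodeckijNorm σ ρ f < ⊤

end

/-! Put `κ = 3p - 2q - 1 = 1 + q(σ - 1)`. The task is to compare the energy with the double integral
of `|γ'(u+w) - γ'(u)|^q / |w|^κ`. The lower bound on `p` says `κ > 2`, which puts the seminorm in
the range of Morrey's embedding.

From energy to regularity: on triples `u, u+v, u+h` with `v/h` in `(1/4, 1/2)`, and at a scale where
tangents differ by at most `1`, the integrand controls the difference of the chord directions from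
`u` to `u+h` and to `u+v` (`TangentsClose.secantDir_sub_le`). Telescoping along dilates of `h` and
averaging over the ratio replaces the second direction by its limit `γ'(u)`
(`lintegral_sub_limit_le`). Since a chord has the same direction seen from both ends, the triangle
inequality gives the Gagliardo integral at that scale, with a constant independent of `γ`
(`TangentsClose.gagliardoLocal_le`).

The scale itself must depend on the energy only. Morrey's estimate improves the oscillation bound
for `γ'` from `1` to `1/2` as long as `δ^(κ-2)` times the energy is small, so a continuity argument
pushes the admissible scale up to such `δ` (`tangentsClose_of_energy`). A closed curve cannot have
close tangents at scale `1/2`; hence the energy is bounded below (`one_lt_energy`), and additive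
constants can be absorbed. Distances beyond `δ` contribute at most a multiple of `δ^(-κ)`, the
source of the exponent `β = κ/(κ-2)`.

From regularity to energy: an injective unit speed `C¹` curve is bi-Lipschitz. Taking `x` opposite
the longest side, the integrand at `x, x+v, x+w` is at most a homogeneous weight times the `q`-th
powers of the deviations of two secants from `γ'(x)` (`apexKernel_le`). Integrating out one
parameter leaves `|v|^(-κ)` (`lintegral_weight`, `weightConst_ne_top`), and Jensen's inequality
passes from secants to tangents (`lintegral_secant_sub_le`). -/

noncomputable section

/-! ### Secants and tangents of closed curves -/

section CurveBasics

variable {n : ℕ} {γ : UnitAddCircle → EuclideanSpace ℝ (Fin n)}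

theorem curveDeriv_coe (γ : UnitAddCircle → EuclideanSpace ℝ (Fin n)) (x : ℝ) :
    curveDeriv γ (x : UnitAddCircle) = deriv (fun t : ℝ => γ (t : UnitAddCircle)) x := by
  have := deriv_comp_const_add (f := fun t : ℝ => γ (t : UnitAddCircle)) x 0
  simp only [AddCircle.coe_add, add_zero] at this
  exact this

theorem IsC1Curve.hasDerivAt (hγ : IsC1Curve γ) (u : UnitAddCircle) (t : ℝ) :
    HasDerivAt (fun t : ℝ => γ (u + (t : UnitAddCircle)))
      (curveDeriv γ (u + (t : UnitAddCircle))) t := by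
  induction u using QuotientAddGroup.induction_on with
  | H x =>
    have h : HasDerivAt (fun t : ℝ => γ (t : UnitAddCircle))
        (curveDeriv γ ((x + t : ℝ) : UnitAddCircle)) (x + t) := by
      rw [curveDeriv_coe]
      exact (hγ.differentiable (by simp) _).hasDerivAt
    have h2 := h.comp_const_add x t
    simpa only [AddCircle.coe_add] using h2

theorem IsC1Curve.continuous (hγ : IsC1Curve γ) : Continuous γ :=
  (QuotientAddGroup.isQuotientMap_mk _).continuous_iff.2 (ContDiff.continuous hγ)

theorem IsC1Curve.continuous_curveDeriv (hγ : IsC1Curve γ) : Continuous (curveDeriv γ) := by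
  refine (QuotientAddGroup.isQuotientMap_mk _).continuous_iff.2 ?_
  have : (curveDeriv γ) ∘ (QuotientAddGroup.mk : ℝ → UnitAddCircle) =
      deriv (fun t : ℝ => γ (t : UnitAddCircle)) := by
    funext x
    exact curveDeriv_coe γ x
  rw [this]
  exact hγ.continuous_deriv (by simp)

/-- The difference quotient of a closed curve. -/
def secant (γ : UnitAddCircle → EuclideanSpace ℝ (Fin n)) (u : UnitAddCircle) (h : ℝ) :
    EuclideanSpace ℝ (Fin n) :=
  h⁻¹ • (γ (u + (h : UnitAddCircle)) - γ u)

/-- The direction of the secant through `γ u` and `γ (u + h)`. -/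
def secantDir (γ : UnitAddCircle → EuclideanSpace ℝ (Fin n)) (u : UnitAddCircle) (h : ℝ) :
    EuclideanSpace ℝ (Fin n) :=
  ‖secant γ u h‖⁻¹ • secant γ u h

theorem smul_secant (γ : UnitAddCircle → EuclideanSpace ℝ (Fin n)) (u : UnitAddCircle) {h : ℝ}
    (hh : h ≠ 0) : h • secant γ u h = γ (u + (h : UnitAddCircle)) - γ u := by
  rw [secant, smul_smul, mul_inv_cancel₀ hh, one_smul]

theorem secant_add_neg (γ : UnitAddCircle → EuclideanSpace ℝ (Fin n)) (u : UnitAddCircle) (h : ℝ) :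
    secant γ (u + (h : UnitAddCircle)) (-h) = secant γ u h := by
  simp only [secant, AddCircle.coe_neg, add_neg_cancel_right, inv_neg, neg_smul, ← smul_neg,
    neg_sub]

theorem secantDir_add_neg (γ : UnitAddCircle → EuclideanSpace ℝ (Fin n)) (u : UnitAddCircle)
    (h : ℝ) : secantDir γ (u + (h : UnitAddCircle)) (-h) = secantDir γ u h := by
  simp only [secantDir, secant_add_neg]

/-- The mean value theorem fails for vector-valued maps but holds for each scalar component. The
bounds on secants below follow by choosing `e`. -/
theorem IsC1Curve.exists_inner_secant (hγ : IsC1Curve γ) (u : UnitAddCircle) {h : ℝ} (hh : h ≠ 0)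
    (e : EuclideanSpace ℝ (Fin n)) : ∃ t ∈ Ioo (0 : ℝ) 1,
      inner ℝ e (secant γ u h) = inner ℝ e (curveDeriv γ (u + ((t * h : ℝ) : UnitAddCircle))) := by
  have hd : ∀ t : ℝ, HasDerivAt
      (fun t : ℝ => h⁻¹ * inner ℝ e (γ (u + ((t * h : ℝ) : UnitAddCircle))))
      (inner ℝ e (curveDeriv γ (u + ((t * h : ℝ) : UnitAddCircle)))) t := by
    intro t
    have h1 := (hγ.hasDerivAt u (t * h)).scomp t ((hasDerivAt_id t).mul_const h)
    have h2 := ((hasDerivAt_const t e).inner ℝ h1).const_mul h⁻¹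
    rw [inner_zero_left, add_zero, one_mul, inner_smul_right, inv_mul_cancel_left₀ hh] at h2
    exact h2
  obtain ⟨t, ht, h1⟩ := exists_hasDerivAt_eq_slope _ _ (zero_lt_one (α := ℝ))
    (fun x _ => (hd x).continuousAt.continuousWithinAt) (fun x _ => hd x)
  refine ⟨t, ht, ?_⟩
  rw [h1]
  simp [secant, inner_smul_right, inner_sub_right, mul_sub]

theorem measurable_secant (hγ : Continuous γ) :
    Measurable (fun x : UnitAddCircle × ℝ => secant γ x.1 x.2) := by
  unfold secant
  have h2 : Continuous (fun x : UnitAddCircle × ℝ => (x.2 : UnitAddCircle)) :=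
    (AddCircle.continuous_mk' 1).comp continuous_snd
  have h3 : Continuous (fun x : UnitAddCircle × ℝ => γ (x.1 + (x.2 : UnitAddCircle)) - γ x.1) := by
    fun_prop
  exact (measurable_snd.inv).smul h3.measurable

theorem measurable_secantDir (hγ : Continuous γ) :
    Measurable (fun x : UnitAddCircle × ℝ => secantDir γ x.1 x.2) := by
  unfold secantDir
  exact (measurable_secant hγ).norm.inv.smul (measurable_secant hγ)

theorem IsC1Curve.tendsto_secant (hγ : IsC1Curve γ) (u : UnitAddCircle) :
    Filter.Tendsto (secant γ u) (nhdsWithin 0 {0}ᶜ) (nhds (curveDeriv γ u)) := by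
  have h := (hγ.hasDerivAt u 0).tendsto_slope_zero
  simp only [zero_add, AddCircle.coe_zero, add_zero] at h
  exact h

theorem IsC1Curve.tendsto_secantDir (hγ : IsC1Curve γ) {u : UnitAddCircle}
    (h1 : ‖curveDeriv γ u‖ = 1) :
    Filter.Tendsto (secantDir γ u) (nhdsWithin 0 {0}ᶜ) (nhds (curveDeriv γ u)) := by
  have := (hγ.tendsto_secant u)
  have h2 := (this.norm.inv₀ (by rw [h1]; exact one_ne_zero)).smul this
  rw [h1, inv_one, one_smul] at h2
  exact h2

theorem IsC1Curve.norm_secant_le (hγ : IsC1Curve γ) (h1 : ∀ u, ‖curveDeriv γ u‖ = 1)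
    (u : UnitAddCircle) (h : ℝ) : ‖secant γ u h‖ ≤ 1 := by
  rcases eq_or_ne h 0 with rfl | hh
  · simp [secant]
  obtain ⟨t, -, ht⟩ := hγ.exists_inner_secant u hh (secant γ u h)
  rw [real_inner_self_eq_norm_sq] at ht
  have h2 := real_inner_le_norm (secant γ u h)
    (curveDeriv γ (u + ((t * h : ℝ) : UnitAddCircle)))
  rw [h1] at h2
  nlinarith [norm_nonneg (secant γ u h)]

theorem norm_sub_eq_abs_mul_norm_secant (γ : UnitAddCircle → EuclideanSpace ℝ (Fin n))
    (u : UnitAddCircle) (h : ℝ) :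
    ‖γ (u + (h : UnitAddCircle)) - γ u‖ = |h| * ‖secant γ u h‖ := by
  rcases eq_or_ne h 0 with rfl | hh
  · simp
  rw [← smul_secant γ u hh, norm_smul, Real.norm_eq_abs]

/-- The tangents of a unit speed curve at parameters of distance less than `δ` enclose an angle
of at most `π / 3`. -/
def TangentsClose (γ : UnitAddCircle → EuclideanSpace ℝ (Fin n)) (δ : ℝ) : Prop :=
  ∀ (u : UnitAddCircle) (w : ℝ), |w| < δ →
    ‖curveDeriv γ (u + (w : UnitAddCircle)) - curveDeriv γ u‖ ≤ 1

theorem TangentsClose.half_le_inner {δ : ℝ} (hP : TangentsClose γ δ)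
    (h1 : ∀ u, ‖curveDeriv γ u‖ = 1) (u : UnitAddCircle) {v w : ℝ} (hvw : |v - w| < δ) :
    1 / 2 ≤ inner ℝ (curveDeriv γ (u + (v : UnitAddCircle)))
      (curveDeriv γ (u + (w : UnitAddCircle))) := by
  have h := hP (u + (w : UnitAddCircle)) (v - w) hvw
  rw [AddCircle.coe_sub, add_assoc, add_sub_cancel] at h
  have h2 := norm_sub_sq_real (curveDeriv γ (u + (v : UnitAddCircle)))
    (curveDeriv γ (u + (w : UnitAddCircle)))
  rw [h1, h1] at h2
  nlinarith [norm_nonneg (curveDeriv γ (u + (v : UnitAddCircle)) -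
    curveDeriv γ (u + (w : UnitAddCircle)))]

theorem TangentsClose.half_le_inner_secant {δ : ℝ} (hP : TangentsClose γ δ) (hγ : IsC1Curve γ)
    (h1 : ∀ u, ‖curveDeriv γ u‖ = 1) (u : UnitAddCircle) {h v t : ℝ} (hh : |h| < δ) (hh0 : h ≠ 0)
    (ht : t ∈ Icc (0 : ℝ) 1) (hv : v = t * h) :
    1 / 2 ≤ inner ℝ (curveDeriv γ (u + (v : UnitAddCircle))) (secant γ u h) := by
  obtain ⟨r, hr, e⟩ := hγ.exists_inner_secant u hh0 (curveDeriv γ (u + (v : UnitAddCircle)))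
  rw [e]
  refine hP.half_le_inner h1 u (lt_of_le_of_lt ?_ hh)
  rw [hv, ← sub_mul, abs_mul]
  have : |t - r| ≤ 1 := by rw [abs_le]; constructor <;> linarith [ht.1, ht.2, hr.1, hr.2]
  nlinarith [abs_nonneg h]

theorem TangentsClose.half_le_norm_secant {δ : ℝ} (hP : TangentsClose γ δ) (hγ : IsC1Curve γ)
    (h1 : ∀ u, ‖curveDeriv γ u‖ = 1) (u : UnitAddCircle) {h : ℝ} (hh : |h| < δ) (hh0 : h ≠ 0) :
    1 / 2 ≤ ‖secant γ u h‖ := by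
  have h2 := hP.half_le_inner_secant hγ h1 u hh hh0 (t := 0) (by simp) rfl
  refine h2.trans ((real_inner_le_norm _ _).trans ?_)
  rw [h1, one_mul]

/-- Supplies the acute angle needed to bound a difference of chord directions by a wedge product. -/
theorem TangentsClose.inner_secant_secant_nonneg {δ : ℝ} (hP : TangentsClose γ δ)
    (hγ : IsC1Curve γ) (h1 : ∀ u, ‖curveDeriv γ u‖ = 1) (u : UnitAddCircle) {h t : ℝ}
    (hh : |h| < δ) (hh0 : h ≠ 0) (ht : t ∈ Ioo (0 : ℝ) 1) :
    0 ≤ inner ℝ (secant γ u h) (secant γ u (t * h)) := by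
  obtain ⟨r, hr, e⟩ := hγ.exists_inner_secant u (mul_ne_zero ht.1.ne' hh0) (secant γ u h)
  rw [e, real_inner_comm]
  have := hP.half_le_inner_secant hγ h1 u hh hh0 (v := r * (t * h)) (t := r * t)
    ⟨mul_nonneg hr.1.le ht.1.le, mul_le_one₀ hr.2.le ht.1.le ht.2.le⟩ (by ring)
  linarith

end CurveBasics

/-! ### The wedge product and differences of directions -/

section Wedge

variable {n : ℕ}

theorem wedgeNorm_nonneg (a b : EuclideanSpace ℝ (Fin n)) : 0 ≤ wedgeNorm a b := Real.sqrt_nonneg _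

theorem wedgeNorm_smul_smul (x y : ℝ) (a b : EuclideanSpace ℝ (Fin n)) :
    wedgeNorm (x • a) (y • b) = |x| * |y| * wedgeNorm a b := by
  unfold wedgeNorm
  rw [norm_smul, norm_smul, inner_smul_left, inner_smul_right, ← abs_mul, ← Real.sqrt_sq_eq_abs,
    ← Real.sqrt_mul (sq_nonneg _)]
  congr 1
  simp only [Real.norm_eq_abs, mul_pow, sq_abs, conj_trivial]
  ring

theorem wedgeNorm_comm (a b : EuclideanSpace ℝ (Fin n)) : wedgeNorm a b = wedgeNorm b a := by
  unfold wedgeNorm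
  rw [real_inner_comm, mul_comm]

theorem wedgeNorm_sub_left (a b : EuclideanSpace ℝ (Fin n)) :
    wedgeNorm (a - b) b = wedgeNorm a b := by
  unfold wedgeNorm
  rw [norm_sub_sq_real, inner_sub_left, real_inner_self_eq_norm_sq]
  congr 1
  ring

theorem wedgeNorm_le (a b : EuclideanSpace ℝ (Fin n)) : wedgeNorm a b ≤ ‖a‖ * ‖b‖ := by
  unfold wedgeNorm
  refine Real.sqrt_le_iff.2 ⟨by positivity, ?_⟩
  rw [mul_pow]
  linarith [sq_nonneg (inner ℝ a b)]

theorem wedgeNorm_neg_left (a b : EuclideanSpace ℝ (Fin n)) :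
    wedgeNorm (-a) b = wedgeNorm a b := by
  unfold wedgeNorm
  rw [norm_neg, inner_neg_left, neg_sq]

/-- For vectors enclosing an acute angle the wedge product controls the distance of directions. -/
theorem norm_normalize_sub_le (a b : EuclideanSpace ℝ (Fin n)) (ha : a ≠ 0) (hb : b ≠ 0)
    (hab : 0 ≤ inner ℝ a b) :
    ‖a‖ * ‖b‖ * ‖‖a‖⁻¹ • a - ‖b‖⁻¹ • b‖ ≤ 2 * wedgeNorm a b := by
  have ha' : 0 < ‖a‖ := norm_pos_iff.2 ha
  have hb' : 0 < ‖b‖ := norm_pos_iff.2 hb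
  have h0 := real_inner_le_norm a b
  refine le_of_sq_le_sq ?_ (by have := wedgeNorm_nonneg a b; positivity)
  rw [mul_pow, mul_pow _ (wedgeNorm a b), wedgeNorm, Real.sq_sqrt (by nlinarith), norm_sub_sq_real,
    norm_smul, norm_smul, inner_smul_left, inner_smul_right]
  simp only [norm_inv, norm_norm, conj_trivial]
  -- With `A = ‖a‖‖b‖` and `I = ⟨a,b⟩`, the squared sides are `2A(A - I)` and `4(A - I)(A + I)`; the
  -- acute angle gives `A ≤ A + I`.
  have e : (‖a‖ * ‖b‖) ^ 2 * ((‖a‖⁻¹ * ‖a‖) ^ 2 - 2 * (‖a‖⁻¹ * (‖b‖⁻¹ * inner ℝ a b)) +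
      (‖b‖⁻¹ * ‖b‖) ^ 2) = 2 * (‖a‖ * ‖b‖) * (‖a‖ * ‖b‖ - inner ℝ a b) := by
    field_simp
    ring
  rw [e]
  have h3 : 0 ≤ (‖a‖ * ‖b‖ - inner ℝ a b) := by linarith
  have h4 : 0 < ‖a‖ * ‖b‖ := by positivity
  nlinarith [mul_nonneg h3 hab, mul_nonneg h3 h4.le]

end Wedge

/-! ### Dilations and telescoping towards a limit -/

section Scaling

theorem lintegral_comp_mul_left_real {c : ℝ} (hc : c ≠ 0) (f : ℝ → ℝ≥0∞) :
    ∫⁻ x, f (c * x) = ENNReal.ofReal |c⁻¹| * ∫⁻ x, f x := by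
  have h := (Homeomorph.mulLeft₀ c hc).measurableEmbedding.lintegral_map (μ := volume) f
  have e : Measure.map (Homeomorph.mulLeft₀ c hc) volume = ENNReal.ofReal |c⁻¹| • volume :=
    Real.map_volume_mul_left hc
  rw [e, lintegral_smul_measure] at h
  exact h.symm

theorem setLIntegral_Ioo_comp_mul_le {c δ : ℝ} (hc : 0 < c) (hc1 : c ≤ 1) (f : ℝ → ℝ≥0∞) :
    ∫⁻ x in Ioo (-δ) δ, f (c * x) ≤ ENNReal.ofReal c⁻¹ * ∫⁻ x in Ioo (-δ) δ, f x := by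
  have h := lintegral_comp_mul_left_real hc.ne' ((Ioo (-δ) δ).indicator f)
  rw [abs_of_pos (inv_pos.2 hc), lintegral_indicator measurableSet_Ioo] at h
  rw [← h, ← lintegral_indicator measurableSet_Ioo]
  refine lintegral_mono fun x => ?_
  by_cases hx : x ∈ Ioo (-δ) δ
  · have : c * x ∈ Ioo (-δ) δ := by
      rw [mem_Ioo, ← abs_lt] at hx ⊢
      rw [abs_mul, abs_of_pos hc]
      nlinarith [abs_nonneg x]
    simp [hx, this]
  · simp [hx]

theorem setLIntegral_preimage_div {h : ℝ} (hh : h ≠ 0) {s : Set ℝ} (hs : MeasurableSet s)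
    (f : ℝ → ℝ≥0∞) :
    ∫⁻ t in s, f (t * h) = ENNReal.ofReal |h|⁻¹ * ∫⁻ v in (fun v => v / h) ⁻¹' s, f v := by
  have hm : MeasurableSet ((fun v : ℝ => v / h) ⁻¹' s) := (measurable_id.div_const h) hs
  have e := lintegral_comp_mul_left_real hh (((fun v => v / h) ⁻¹' s).indicator f)
  rw [abs_inv, lintegral_indicator hm] at e
  rw [← e, ← lintegral_indicator hs]
  refine lintegral_congr fun t => ?_
  have hmem : h * t ∈ (fun v : ℝ => v / h) ⁻¹' s ↔ t ∈ s := by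
    rw [mem_preimage, mul_div_cancel_left₀ t hh]
  by_cases ht : t ∈ s
  · rw [indicator_of_mem ht, indicator_of_mem (hmem.2 ht), mul_comm]
  · rw [indicator_of_notMem ht, indicator_of_notMem (mt hmem.1 ht)]

/-- Each `x k` is at most `ρ^(k/q)` times the `q`-th root of the weighted sum, so a geometric series
bounds the total. This replaces Minkowski's inequality and works for every `q > 0`. -/
theorem ENNReal.tsum_rpow_le {q : ℝ} (hq : 0 < q) {ρ : ℝ≥0∞} (h0 : ρ ≠ 0) (ht : ρ ≠ ⊤)
    (x : ℕ → ℝ≥0∞) :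
    (∑' k, x k) ^ q ≤ ((1 - ρ ^ (1 / q))⁻¹) ^ q * ∑' k, (ρ⁻¹) ^ k * x k ^ q := by
  set M := ∑' k, (ρ⁻¹) ^ k * x k ^ q with hM
  have hx : ∀ k, x k ≤ (ρ ^ (1 / q)) ^ k * M ^ (1 / q) := by
    intro k
    have h1 : (ρ⁻¹) ^ k * x k ^ q ≤ M := ENNReal.le_tsum k
    have h2 : x k ^ q ≤ ρ ^ k * M := by
      calc x k ^ q = ρ ^ k * ((ρ⁻¹) ^ k * x k ^ q) := by
            rw [← mul_assoc, ← mul_pow, ENNReal.mul_inv_cancel h0 ht, one_pow, one_mul]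
        _ ≤ _ := by gcongr
    calc x k = (x k ^ q) ^ (1 / q) := by
          rw [← ENNReal.rpow_mul, mul_one_div_cancel hq.ne', ENNReal.rpow_one]
      _ ≤ (ρ ^ k * M) ^ (1 / q) := by gcongr
      _ = _ := by
          rw [ENNReal.mul_rpow_of_nonneg _ _ (by positivity), ← ENNReal.rpow_natCast,
            ← ENNReal.rpow_mul, mul_comm (k : ℝ), ENNReal.rpow_mul, ENNReal.rpow_natCast]
  calc (∑' k, x k) ^ q ≤ (∑' k, (ρ ^ (1 / q)) ^ k * M ^ (1 / q)) ^ q := by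
        gcongr with k
        exact hx k
    _ = _ := by
        rw [ENNReal.tsum_mul_right, ENNReal.tsum_geometric,
          ENNReal.mul_rpow_of_nonneg _ _ hq.le, ← ENNReal.rpow_mul, one_div_mul_cancel hq.ne',
          ENNReal.rpow_one]

theorem ofReal_norm_sub_rpow_div {V : Type*} [NormedAddCommGroup V] {q : ℝ} (hq : 0 ≤ q) (a b : V)
    (κ h : ℝ) :
    ENNReal.ofReal (‖a - b‖ ^ q / |h| ^ κ) = edist a b ^ q * ENNReal.ofReal ((|h| ^ κ)⁻¹) := by
  rw [div_eq_mul_inv, ENNReal.ofReal_mul (by positivity), ← ENNReal.ofReal_rpow_of_nonneg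
    (norm_nonneg _) hq, ← dist_eq_norm, edist_dist]

/-- The constant in the estimate of the distance to the limit by dilates. -/
def dilateConst (q κ : ℝ) : ℝ≥0∞ :=
  ((1 - ((1 / 2 : ℝ≥0∞) ^ ((κ - 1) / 2)) ^ (1 / q))⁻¹) ^ q *
    (1 - (1 / 2 : ℝ≥0∞) ^ ((κ - 1) / 2))⁻¹

theorem dilateConst_ne_top {q κ : ℝ} (hq : 0 < q) (hκ : 1 < κ) : dilateConst q κ ≠ ⊤ := by
  have h1 : (1 / 2 : ℝ≥0∞) ^ ((κ - 1) / 2) < 1 :=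
    ENNReal.rpow_lt_one (by simp) (by linarith)
  have h2 : ((1 / 2 : ℝ≥0∞) ^ ((κ - 1) / 2)) ^ (1 / q) < 1 :=
    ENNReal.rpow_lt_one h1 (by positivity)
  refine ENNReal.mul_ne_top (ENNReal.rpow_ne_top_of_nonneg hq.le ?_) ?_
  · exact ENNReal.inv_ne_top.2 (tsub_pos_of_lt h2).ne'
  · exact ENNReal.inv_ne_top.2 (tsub_pos_of_lt h1).ne'

/-- Telescope `φ h - a` over the points `c^k h`. Substitution in the `k`-th term gains `c^(k(κ-1)) ≤
ρ^(2k)`, where `ρ = 2^(-(κ-1)/2)`: one factor `ρ^k` pays for the weights of `ENNReal.tsum_rpow_le`,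
the other makes the sum converge. -/
theorem lintegral_sub_limit_le_dilate {V : Type*} [NormedAddCommGroup V] [MeasurableSpace V]
    [BorelSpace V] [SecondCountableTopology V]
    {q κ : ℝ} (hq : 0 < q) (hκ : 1 < κ) {c : ℝ} (hc : 0 < c) (hc2 : c ≤ 1 / 2)
    {φ : ℝ → V} (hφ : Measurable φ) {a : V}
    (hlim : Filter.Tendsto φ (nhdsWithin 0 {0}ᶜ) (nhds a)) (δ : ℝ) :
    ∫⁻ h in Ioo (-δ) δ, ENNReal.ofReal (‖φ h - a‖ ^ q / |h| ^ κ) ≤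
      dilateConst q κ *
        ∫⁻ h in Ioo (-δ) δ, ENNReal.ofReal (‖φ h - φ (c * h)‖ ^ q / |h| ^ κ) := by
  set ρ : ℝ≥0∞ := (1 / 2 : ℝ≥0∞) ^ ((κ - 1) / 2) with hρ
  have hρ0 : ρ ≠ 0 := (ENNReal.rpow_pos (by simp) (by simp)).ne'
  have hρt : ρ ≠ ⊤ := ENNReal.rpow_ne_top_of_nonneg (by linarith) (by simp)
  set ψ : ℝ → ℝ≥0∞ := fun h => ENNReal.ofReal (‖φ h - φ (c * h)‖ ^ q / |h| ^ κ) with hψ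
  have hψm : Measurable ψ := by
    have : Measurable fun h => φ (c * h) := hφ.comp (measurable_const_mul c)
    fun_prop
  set I := ∫⁻ h in Ioo (-δ) δ, ψ h
  have hpt : ∀ h : ℝ, ENNReal.ofReal (‖φ h - a‖ ^ q / |h| ^ κ) ≤
      ((1 - ρ ^ (1 / q))⁻¹) ^ q *
        ∑' k : ℕ, (ρ⁻¹) ^ k * (ENNReal.ofReal ((c ^ k) ^ κ) * ψ (c ^ k * h)) := by
    intro h
    rcases eq_or_ne h 0 with rfl | hh
    · simp [Real.zero_rpow (by linarith : κ ≠ 0)]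
    have hw : ∀ k : ℕ, ENNReal.ofReal ((c ^ k) ^ κ) * ψ (c ^ k * h) =
        edist (φ (c ^ k * h)) (φ (c ^ (k + 1) * h)) ^ q * ENNReal.ofReal ((|h| ^ κ)⁻¹) := by
      intro k
      have hk : 0 < c ^ k := pow_pos hc k
      simp only [hψ]
      rw [ofReal_norm_sub_rpow_div hq.le, abs_mul, abs_of_pos hk,
        Real.mul_rpow hk.le (abs_nonneg h), mul_left_comm, ← ENNReal.ofReal_mul (by positivity),
        mul_inv, mul_inv_cancel_left₀ (by positivity), ← mul_assoc c, ← pow_succ']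
    simp_rw [hw, ← mul_assoc]
    rw [ENNReal.tsum_mul_right, ofReal_norm_sub_rpow_div hq.le, ← mul_assoc]
    gcongr
    refine le_trans ?_ (ENNReal.tsum_rpow_le hq hρ0 hρt _)
    gcongr
    have hl : Filter.Tendsto (fun k : ℕ => φ (c ^ k * h)) Filter.atTop (nhds a) := by
      refine hlim.comp (tendsto_nhdsWithin_iff.2 ⟨?_, Filter.Eventually.of_forall fun k => ?_⟩)
      · simpa using (tendsto_pow_atTop_nhds_zero_of_lt_one hc.le
          (by linarith : c < 1)).mul_const h
      · exact mul_ne_zero (pow_pos hc k).ne' hh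
    have := edist_le_tsum_of_edist_le_of_tendsto₀ _ (fun k => le_refl _) hl
    simpa using this
  calc ∫⁻ h in Ioo (-δ) δ, ENNReal.ofReal (‖φ h - a‖ ^ q / |h| ^ κ)
      ≤ ∫⁻ h in Ioo (-δ) δ, ((1 - ρ ^ (1 / q))⁻¹) ^ q *
        ∑' k : ℕ, (ρ⁻¹) ^ k * (ENNReal.ofReal ((c ^ k) ^ κ) * ψ (c ^ k * h)) :=
        lintegral_mono hpt
    _ = ((1 - ρ ^ (1 / q))⁻¹) ^ q * ∑' k : ℕ, (ρ⁻¹) ^ k * (ENNReal.ofReal ((c ^ k) ^ κ) *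
          ∫⁻ h in Ioo (-δ) δ, ψ (c ^ k * h)) := by
        have hm : ∀ k : ℕ, Measurable fun h => ψ (c ^ k * h) := fun k =>
          hψm.comp (measurable_const_mul _)
        have hm' : ∀ k : ℕ, Measurable fun h =>
            (ρ⁻¹) ^ k * (ENNReal.ofReal ((c ^ k) ^ κ) * ψ (c ^ k * h)) := fun k =>
          ((hm k).const_mul _).const_mul _
        rw [lintegral_const_mul _ (Measurable.tsum hm'),
          lintegral_tsum (fun k => (hm' k).aemeasurable)]
        congr 2
        funext k
        rw [lintegral_const_mul _ ((hm k).const_mul _), lintegral_const_mul _ (hm k)]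
    _ ≤ ((1 - ρ ^ (1 / q))⁻¹) ^ q * ∑' k : ℕ, ρ ^ k * I := by
        refine mul_le_mul_right (ENNReal.tsum_le_tsum fun k => ?_) _
        have hk : 0 < c ^ k := pow_pos hc k
        calc (ρ⁻¹) ^ k * (ENNReal.ofReal ((c ^ k) ^ κ) * ∫⁻ h in Ioo (-δ) δ, ψ (c ^ k * h))
            ≤ (ρ⁻¹) ^ k * (ENNReal.ofReal ((c ^ k) ^ κ) * (ENNReal.ofReal (c ^ k)⁻¹ * I)) := by
              gcongr
              exact setLIntegral_Ioo_comp_mul_le hk (pow_le_one₀ hc.le (by linarith)) ψ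
          _ = (ρ⁻¹) ^ k * (ENNReal.ofReal (c ^ (κ - 1))) ^ k * I := by
              rw [← mul_assoc (ENNReal.ofReal _), ← ENNReal.ofReal_mul (by positivity),
                ← ENNReal.ofReal_pow (by positivity), ← mul_assoc]
              rw [← div_eq_mul_inv, ← Real.rpow_sub_one hk.ne', Real.rpow_pow_comm hc.le]
          _ ≤ (ρ⁻¹) ^ k * (ρ * ρ) ^ k * I := by
              gcongr
              rw [hρ, ← ENNReal.rpow_add _ _ (by simp) (by simp), add_halves]
              have e : (1 / 2 : ℝ≥0∞) = ENNReal.ofReal (1 / 2) := by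
                rw [ENNReal.ofReal_div_of_pos two_pos]; simp
              rw [e, ENNReal.ofReal_rpow_of_pos (by norm_num)]
              gcongr
          _ = ρ ^ k * I := by
              rw [← mul_pow, ← mul_assoc, ENNReal.inv_mul_cancel hρ0 hρt, one_mul]
    _ = _ := by
        rw [ENNReal.tsum_mul_right, ENNReal.tsum_geometric, ← mul_assoc]
        rfl

/-- Averaging the dilation estimate over `c` in `(1/4, 1/2)` produces the double integral that the
energy controls. The `4` is the reciprocal length of the interval, and the extra power of `|h|`
comes from `v = c h`. -/
theorem lintegral_sub_limit_le {V : Type*} [NormedAddCommGroup V] [MeasurableSpace V]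
    [BorelSpace V] [SecondCountableTopology V]
    {q κ : ℝ} (hq : 0 < q) (hκ : 1 < κ)
    {φ : ℝ → V} (hφ : Measurable φ) {a : V}
    (hlim : Filter.Tendsto φ (nhdsWithin 0 {0}ᶜ) (nhds a)) (δ : ℝ) :
    ∫⁻ h in Ioo (-δ) δ, ENNReal.ofReal (‖φ h - a‖ ^ q / |h| ^ κ) ≤
      4 * dilateConst q κ * ∫⁻ h in Ioo (-δ) δ, ∫⁻ v in (fun v => v / h) ⁻¹' Ioo (1 / 4) (1 / 2),
        ENNReal.ofReal (‖φ h - φ v‖ ^ q / |h| ^ (κ + 1)) := by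
  set X := ∫⁻ h in Ioo (-δ) δ, ENNReal.ofReal (‖φ h - a‖ ^ q / |h| ^ κ)
  have h1 : ∫⁻ _ in Ioo (1 / 4 : ℝ) (1 / 2), X ≤ ∫⁻ c in Ioo (1 / 4 : ℝ) (1 / 2),
      dilateConst q κ *
        ∫⁻ h in Ioo (-δ) δ, ENNReal.ofReal (‖φ h - φ (c * h)‖ ^ q / |h| ^ κ) := by
    refine setLIntegral_mono' measurableSet_Ioo fun c hc => ?_
    exact lintegral_sub_limit_le_dilate hq hκ (by linarith [hc.1]) hc.2.le hφ hlim δ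
  have hm : Measurable (Function.uncurry fun c h : ℝ =>
      ENNReal.ofReal (‖φ h - φ (c * h)‖ ^ q / |h| ^ κ)) := by
    have h1 : Measurable fun x : ℝ × ℝ => φ (x.1 * x.2) :=
      hφ.comp (measurable_fst.mul measurable_snd)
    have h2 : Measurable fun x : ℝ × ℝ => φ x.2 := hφ.comp measurable_snd
    unfold Function.uncurry
    fun_prop
  rw [setLIntegral_const, Real.volume_Ioo, lintegral_const_mul _ hm.lintegral_prod_right,
    lintegral_lintegral_swap hm.aemeasurable] at h1
  have h2 : ENNReal.ofReal (1 / 2 - 1 / 4) = 4⁻¹ := by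
    rw [show (1 / 2 - 1 / 4 : ℝ) = 4⁻¹ by norm_num, ENNReal.ofReal_inv_of_pos (by norm_num)]
    simp
  have h3 : ∫⁻ h in Ioo (-δ) δ, ∫⁻ c in Ioo (1 / 4 : ℝ) (1 / 2),
      ENNReal.ofReal (‖φ h - φ (c * h)‖ ^ q / |h| ^ κ) ≤
      ∫⁻ h in Ioo (-δ) δ, ∫⁻ v in (fun v => v / h) ⁻¹' Ioo (1 / 4) (1 / 2),
        ENNReal.ofReal (‖φ h - φ v‖ ^ q / |h| ^ (κ + 1)) := by
    refine lintegral_mono fun h => ?_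
    rcases eq_or_ne h 0 with rfl | hh
    · simp [Real.zero_rpow (by linarith : κ ≠ 0)]
    have hh' : 0 < |h| := abs_pos.2 hh
    dsimp only
    rw [setLIntegral_preimage_div hh measurableSet_Ioo
      (fun v => ENNReal.ofReal (‖φ h - φ v‖ ^ q / |h| ^ κ)), ← lintegral_const_mul' _ _ (by simp)]
    refine lintegral_mono fun v => ?_
    rw [← ENNReal.ofReal_mul (by positivity), Real.rpow_add_one hh'.ne']
    refine le_of_eq (congrArg _ ?_)
    field_simp
  rw [h2] at h1
  calc X = 4 * (X * 4⁻¹) := by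
        rw [mul_comm, mul_assoc, ENNReal.inv_mul_cancel (by simp) (by simp), mul_one]
    _ ≤ _ := by
        rw [mul_assoc 4]
        exact mul_le_mul_right (h1.trans (mul_le_mul_right h3 _)) 4

end Scaling

/-! ### The energy bounds the seminorm where tangents are close -/

section LocalEstimate

variable {n : ℕ} {γ : UnitAddCircle → EuclideanSpace ℝ (Fin n)}

/-- The integrand of the integral Menger curvature of a unit speed curve. -/
def mengerKernel (p q : ℝ) (γ : UnitAddCircle → EuclideanSpace ℝ (Fin n))
    (x y z : UnitAddCircle) : ℝ≥0∞ :=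
  ENNReal.ofReal (wedgeNorm (γ y - γ x) (γ z - γ x) ^ q /
    (‖γ y - γ z‖ * ‖γ y - γ x‖ * ‖γ z - γ x‖) ^ p)

theorem mengerEnergy_eq (p q : ℝ) (h1 : ∀ u, ‖curveDeriv γ u‖ = 1) :
    mengerEnergy p q γ = ∫⁻ x, ∫⁻ y, ∫⁻ z, mengerKernel p q γ x y z := by
  simp only [mengerEnergy, mengerKernel, h1, mengerR, mul_one, one_div_div]

theorem measurable_mengerKernel {α : Type*} [MeasurableSpace α] (p q : ℝ) (hγ : Continuous γ)
    {x y z : α → UnitAddCircle} (hx : Measurable x) (hy : Measurable y) (hz : Measurable z) :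
    Measurable fun a => mengerKernel p q γ (x a) (y a) (z a) := by
  have hw : Continuous fun x : UnitAddCircle × UnitAddCircle × UnitAddCircle =>
      wedgeNorm (γ x.2.1 - γ x.1) (γ x.2.2 - γ x.1) := by
    unfold wedgeNorm
    fun_prop
  have hd : Continuous fun x : UnitAddCircle × UnitAddCircle × UnitAddCircle =>
      ‖γ x.2.1 - γ x.2.2‖ * ‖γ x.2.1 - γ x.1‖ * ‖γ x.2.2 - γ x.1‖ := by
    fun_prop
  have h3 := hx.prodMk (hy.prodMk hz)
  exact (((hw.measurable.comp h3).pow_const q).div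
    ((hd.measurable.comp h3).pow_const p)).ennreal_ofReal

theorem setLIntegral_Ioo_coe_le {δ : ℝ} (hδ : δ ≤ 1 / 2) (f : UnitAddCircle → ℝ≥0∞)
    (u : UnitAddCircle) :
    ∫⁻ h in Ioo (-δ) δ, f (u + (h : UnitAddCircle)) ≤ ∫⁻ x, f x := by
  rw [← lintegral_add_left_eq_self f u,
    ← UnitAddCircle.lintegral_preimage (-(1 / 2)) (fun x => f (u + x))]
  refine lintegral_mono_set fun x hx => ⟨?_, ?_⟩
  · linarith [hx.1]
  · linarith [hx.2]

theorem setLIntegral_Ioo_neg (δ : ℝ) (f : ℝ → ℝ≥0∞) :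
    ∫⁻ h in Ioo (-δ) δ, f (-h) = ∫⁻ h in Ioo (-δ) δ, f h := by
  have := (Measure.measurePreserving_neg (volume : Measure ℝ)).setLIntegral_comp_preimage_emb
    (MeasurableEquiv.neg ℝ).measurableEmbedding f (Ioo (-δ) δ)
  rw [← this]
  simp

/-- The ratio window keeps `|v|` comparable to `|h|`, so the wedge product is at least of order
`|h|^2` times the difference of directions, while the product of the side lengths is at most
`|h|^3`. -/
theorem TangentsClose.secantDir_sub_le {p q δ : ℝ} (hp : 0 < p) (hq : 0 < q)
    (hP : TangentsClose γ δ) (hγ : IsC1Curve γ)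
    (h1 : ∀ u, ‖curveDeriv γ u‖ = 1) (u : UnitAddCircle) {h v : ℝ} (hh : |h| < δ)
    (hv : v / h ∈ Ioo (1 / 4 : ℝ) (1 / 2)) :
    ENNReal.ofReal (‖secantDir γ u h - secantDir γ u v‖ ^ q / |h| ^ (3 * p - 2 * q)) ≤
      ENNReal.ofReal (32 ^ q) *
        mengerKernel p q γ u (u + (v : UnitAddCircle)) (u + (h : UnitAddCircle)) := by
  have hh0 : h ≠ 0 := by
    rintro rfl
    norm_num at hv
  obtain ⟨t, ht, rfl⟩ : ∃ t ∈ Ioo (1 / 4 : ℝ) (1 / 2), v = t * h := ⟨v / h, hv, by field_simp⟩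
  have ht0 : 0 < t := by linarith [ht.1]
  have hh' : 0 < |h| := abs_pos.2 hh0
  have hv0 : t * h ≠ 0 := mul_ne_zero ht0.ne' hh0
  have hvh : |t * h| ≤ |h| := by
    rw [abs_mul, abs_of_pos ht0]
    nlinarith [ht.2]
  have hvh4 : |h| / 4 ≤ |t * h| := by
    rw [abs_mul, abs_of_pos ht0]
    nlinarith [ht.1]
  have hw0 : h - t * h ≠ 0 := by
    rw [← one_sub_mul]
    exact mul_ne_zero (by linarith [ht.2]) hh0
  have hwh : |h - t * h| ≤ |h| := by
    rw [← one_sub_mul, abs_mul, abs_of_pos (by linarith [ht.2])]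
    nlinarith
  set T := ‖secantDir γ u h - secantDir γ u (t * h)‖ with hT
  have hah := hP.half_le_norm_secant hγ h1 u hh hh0
  have hav := hP.half_le_norm_secant hγ h1 u (hvh.trans_lt hh) hv0
  have haw := hP.half_le_norm_secant hγ h1 (u + ((t * h : ℝ) : UnitAddCircle))
    (hwh.trans_lt hh) hw0
  -- `32 = 4 · 4 · 2`: from `|v| ≥ |h|/4`, from two secants of norm at least `1/2`, and from
  -- `norm_normalize_sub_le`.
  have hW : |h| ^ 2 * T / 32 ≤ wedgeNorm (γ (u + ((t * h : ℝ) : UnitAddCircle)) - γ u)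
      (γ (u + (h : UnitAddCircle)) - γ u) := by
    rw [← smul_secant γ u hv0, ← smul_secant γ u hh0, wedgeNorm_smul_smul, wedgeNorm_comm]
    have h3 := norm_normalize_sub_le (secant γ u h) (secant γ u (t * h))
      (norm_pos_iff.1 (by linarith)) (norm_pos_iff.1 (by linarith))
      (hP.inner_secant_secant_nonneg hγ h1 u hh hh0 ⟨ht0, by linarith [ht.2]⟩)
    have h4 : 1 / 4 * T ≤ 2 * wedgeNorm (secant γ u h) (secant γ u (t * h)) := by
      refine le_trans ?_ h3
      refine mul_le_mul_of_nonneg_right ?_ (norm_nonneg _)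
      nlinarith
    have h5 : |h| / 4 * |h| ≤ |t * h| * |h| := by gcongr
    calc |h| ^ 2 * T / 32 = (|h| / 4 * |h|) * (1 / 8 * T) := by ring
      _ ≤ (|t * h| * |h|) * wedgeNorm (secant γ u h) (secant γ u (t * h)) := by
        have : 0 ≤ T := norm_nonneg _
        refine mul_le_mul h5 (by linarith) (by positivity) (by positivity)
  have hyz : ‖γ (u + ((t * h : ℝ) : UnitAddCircle)) - γ (u + (h : UnitAddCircle))‖ =
      |h - t * h| * ‖secant γ (u + ((t * h : ℝ) : UnitAddCircle)) (h - t * h)‖ := by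
    rw [← norm_sub_eq_abs_mul_norm_secant, norm_sub_rev, add_assoc, ← AddCircle.coe_add,
      add_sub_cancel]
  set X := ‖γ (u + ((t * h : ℝ) : UnitAddCircle)) - γ (u + (h : UnitAddCircle))‖ *
    ‖γ (u + ((t * h : ℝ) : UnitAddCircle)) - γ u‖ * ‖γ (u + (h : UnitAddCircle)) - γ u‖ with hX
  -- Needed because division by zero would make the kernel vanish.
  have hX0 : 0 < X := by
    rw [hX, hyz, norm_sub_eq_abs_mul_norm_secant, norm_sub_eq_abs_mul_norm_secant]
    have h6 := abs_pos.2 hv0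
    have h7 := abs_pos.2 hw0
    have : 0 < ‖secant γ u h‖ := by linarith
    have : 0 < ‖secant γ u (t * h)‖ := by linarith
    have : 0 < ‖secant γ (u + ((t * h : ℝ) : UnitAddCircle)) (h - t * h)‖ := by linarith
    positivity
  have hle : ∀ (u : UnitAddCircle) (w : ℝ), |w| ≤ |h| → |w| * ‖secant γ u w‖ ≤ |h| := by
    intro u w hw
    have := hγ.norm_secant_le h1 u w
    nlinarith [abs_nonneg w]
  have hXle : X ≤ |h| ^ 3 := by
    rw [hX, hyz, norm_sub_eq_abs_mul_norm_secant, norm_sub_eq_abs_mul_norm_secant, pow_succ, sq]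
    gcongr
    · exact hle _ _ hwh
    · exact hle _ _ hvh
    · exact hle _ _ le_rfl
  rw [mengerKernel, ← ENNReal.ofReal_mul (by positivity)]
  refine ENNReal.ofReal_le_ofReal ?_
  have hT0 : 0 ≤ T := norm_nonneg _
  calc T ^ q / |h| ^ (3 * p - 2 * q) = 32 ^ q * ((|h| ^ 2 * T / 32) ^ q / (|h| ^ 3) ^ p) := by
        rw [Real.div_rpow (by positivity) (by norm_num), Real.mul_rpow (by positivity) hT0,
          ← Real.rpow_natCast, ← Real.rpow_natCast, ← Real.rpow_mul hh'.le, ← Real.rpow_mul hh'.le,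
          Real.rpow_sub hh']
        push_cast
        field_simp
    _ ≤ _ := by
        have := Real.rpow_nonneg (wedgeNorm_nonneg (γ (u + ((t * h : ℝ) : UnitAddCircle)) - γ u)
          (γ (u + (h : UnitAddCircle)) - γ u)) q
        gcongr

theorem TangentsClose.lintegral_secantDir_sub_le {p q δ : ℝ} (hp : 2 / 3 * q + 1 < p) (hq : 0 < q)
    (hδ : δ ≤ 1 / 2) (hP : TangentsClose γ δ) (hγ : IsC1Curve γ)
    (h1 : ∀ u, ‖curveDeriv γ u‖ = 1) :
    ∫⁻ u, ∫⁻ h in Ioo (-δ) δ,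
        ENNReal.ofReal (‖secantDir γ u h - curveDeriv γ u‖ ^ q / |h| ^ (3 * p - 2 * q - 1)) ≤
      4 * dilateConst q (3 * p - 2 * q - 1) * ENNReal.ofReal (32 ^ q) * mengerEnergy p q γ := by
  have hKu : ∀ u, Measurable (Function.uncurry fun y z => mengerKernel p q γ u y z) := fun u =>
    measurable_mengerKernel p q hγ.continuous measurable_const measurable_fst measurable_snd
  have hK : Measurable (Function.uncurry fun x : UnitAddCircle × UnitAddCircle => fun z =>
      mengerKernel p q γ x.1 x.2 z) :=
    measurable_mengerKernel p q hγ.continuous measurable_fst.fst measurable_fst.snd measurable_snd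
  rw [mengerEnergy_eq p q h1, ← lintegral_const_mul _ hK.lintegral_prod_right.lintegral_prod_right]
  refine lintegral_mono fun u => ?_
  refine (lintegral_sub_limit_le (κ := 3 * p - 2 * q - 1) hq (by linarith)
    ((measurable_secantDir hγ.continuous).comp measurable_prodMk_left)
    (hγ.tendsto_secantDir (h1 u)) δ).trans ?_
  rw [mul_assoc (4 * _)]
  refine mul_le_mul_right ?_ _
  -- The energy has the intermediate point outside; the swap makes the far point `u + h` the outer
  -- variable.
  rw [lintegral_lintegral_swap (hKu u).aemeasurable, ← lintegral_const_mul' _ _ (by simp)]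
  refine le_trans ?_ (setLIntegral_Ioo_coe_le hδ _ u)
  refine setLIntegral_mono' measurableSet_Ioo fun h hh => ?_
  rw [← lintegral_const_mul' _ _ (by simp)]
  refine le_trans ?_ (setLIntegral_Ioo_coe_le hδ _ u)
  have hh' : |h| < δ := abs_lt.2 hh
  refine le_trans (setLIntegral_mono' (g := fun v : ℝ => ENNReal.ofReal (32 ^ q) *
    mengerKernel p q γ u (u + (v : UnitAddCircle)) (u + (h : UnitAddCircle)))
    ((measurable_id.div_const h) measurableSet_Ioo) fun v hv => ?_)
    (lintegral_mono_set fun v hv => ?_)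
  · have := hP.secantDir_sub_le (by linarith : 0 < p) hq hγ h1 u hh' hv
    rwa [sub_add_cancel]
  · rw [mem_Ioo, ← abs_lt]
    have hv' : v / h ∈ Ioo (1 / 4 : ℝ) (1 / 2) := hv
    have hh0 : h ≠ 0 := by
      rintro rfl
      norm_num at hv'
    have : |v / h| ≤ 1 := by rw [abs_le]; constructor <;> linarith [hv'.1, hv'.2]
    rw [abs_div, div_le_one (abs_pos.2 hh0)] at this
    linarith

/-- The `q`-th power of the Gagliardo seminorm with exponent `κ`, restricted to distances less
than `δ`. -/
def gagliardoLocal (κ q δ : ℝ) (g : UnitAddCircle → EuclideanSpace ℝ (Fin n)) : ℝ≥0∞ :=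
  ∫⁻ u : UnitAddCircle, ∫⁻ w : ℝ in Ioo (-δ) δ,
    ENNReal.ofReal (‖g (u + (w : UnitAddCircle)) - g u‖ ^ q / |w| ^ κ)

theorem add_rpow_le_two_rpow_mul {q x y : ℝ} (hq : 0 < q) (hx : 0 ≤ x) (hy : 0 ≤ y) :
    (x + y) ^ q ≤ 2 ^ q * (x ^ q + y ^ q) := by
  wlog h : x ≤ y generalizing x y
  · rw [add_comm, add_comm (x ^ q)]
    exact this hy hx (le_of_not_ge h)
  calc (x + y) ^ q ≤ (2 * y) ^ q := by gcongr; linarith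
    _ = 2 ^ q * y ^ q := Real.mul_rpow two_pos.le hy
    _ ≤ _ := by gcongr; linarith [Real.rpow_nonneg hx q]

/-- The involution `(u, w) ↦ (u + w, -w)` exchanges the endpoints of a chord and preserves measure.
-/
theorem lintegral_add_coe_neg {f : UnitAddCircle → ℝ → ℝ≥0∞} (hf : Measurable (Function.uncurry f))
    (δ : ℝ) :
    ∫⁻ u, ∫⁻ w in Ioo (-δ) δ, f (u + (w : UnitAddCircle)) (-w) =
      ∫⁻ u, ∫⁻ w in Ioo (-δ) δ, f u w := by
  have hc : Measurable (fun x : ℝ => (x : UnitAddCircle)) := (AddCircle.continuous_mk' 1).measurable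
  have hf2 : Measurable (Function.uncurry fun (u : UnitAddCircle) (h : ℝ) =>
      f (u + (h : UnitAddCircle)) (-h)) :=
    hf.comp ((measurable_fst.add (hc.comp measurable_snd)).prodMk measurable_snd.neg)
  have h (w : ℝ) : ∫⁻ u, f (u + (w : UnitAddCircle)) (-w) = ∫⁻ u, f u (-w) :=
    lintegral_add_right_eq_self (fun u => f u (-w)) (w : UnitAddCircle)
  rw [lintegral_lintegral_swap hf2.aemeasurable]
  simp_rw [h]
  rw [setLIntegral_Ioo_neg δ (fun w => ∫⁻ u, f u w), ← lintegral_lintegral_swap hf.aemeasurable]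

theorem measurable_secantDir_sub (q κ : ℝ) (hγ : IsC1Curve γ) :
    Measurable (Function.uncurry fun (u : UnitAddCircle) (h : ℝ) =>
      ENNReal.ofReal (‖secantDir γ u h - curveDeriv γ u‖ ^ q / |h| ^ κ)) := by
  have h1 := measurable_secantDir hγ.continuous
  have h2 : Measurable fun x : UnitAddCircle × ℝ => curveDeriv γ x.1 :=
    hγ.continuous_curveDeriv.measurable.comp measurable_fst
  exact (((h1.sub h2).norm.pow_const q).div
    ((continuous_abs.measurable.comp measurable_snd).pow_const κ)).ennreal_ofReal

/-- Compare both tangents with the direction of the chord joining their base points; the two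
resulting integrals agree by exchanging endpoints. -/
theorem gagliardoLocal_le_lintegral_secantDir {q : ℝ} (κ δ : ℝ) (hq : 0 < q)
    (hγ : IsC1Curve γ) :
    gagliardoLocal κ q δ (curveDeriv γ) ≤ ENNReal.ofReal (2 ^ q) * (2 * ∫⁻ u, ∫⁻ h in Ioo (-δ) δ,
        ENNReal.ofReal (‖secantDir γ u h - curveDeriv γ u‖ ^ q / |h| ^ κ)) := by
  obtain ⟨f, hf⟩ : ∃ f : UnitAddCircle → ℝ → ℝ≥0∞, f = fun u h =>
    ENNReal.ofReal (‖secantDir γ u h - curveDeriv γ u‖ ^ q / |h| ^ κ) := ⟨_, rfl⟩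
  have hfm : Measurable (Function.uncurry f) := hf ▸ measurable_secantDir_sub q κ hγ
  have hpt : ∀ (u : UnitAddCircle) (w : ℝ),
      ENNReal.ofReal (‖curveDeriv γ (u + (w : UnitAddCircle)) - curveDeriv γ u‖ ^ q / |w| ^ κ) ≤
      ENNReal.ofReal (2 ^ q) * (f (u + (w : UnitAddCircle)) (-w) + f u w) := by
    intro u w
    simp only [hf]
    rw [secantDir_add_neg, abs_neg, ← ENNReal.ofReal_add (by positivity) (by positivity),
      ← ENNReal.ofReal_mul (by positivity), ← add_div, ← mul_div_assoc]
    refine ENNReal.ofReal_le_ofReal ?_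
    gcongr
    refine le_trans ?_ (add_rpow_le_two_rpow_mul hq (norm_nonneg _) (norm_nonneg _))
    gcongr
    rw [norm_sub_rev (secantDir γ u w)]
    exact norm_sub_le_norm_sub_add_norm_sub _ _ _
  have e : (∫⁻ u, ∫⁻ h in Ioo (-δ) δ,
      ENNReal.ofReal (‖secantDir γ u h - curveDeriv γ u‖ ^ q / |h| ^ κ)) =
      ∫⁻ u, ∫⁻ h in Ioo (-δ) δ, f u h := by rw [hf]
  rw [e, two_mul]
  nth_rw 1 [← lintegral_add_coe_neg hfm δ]
  rw [← lintegral_add_right _ hfm.lintegral_prod_right, ← lintegral_const_mul' _ _ (by simp)]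
  refine lintegral_mono fun u => ?_
  have hfu : Measurable (f u) := hfm.comp measurable_prodMk_left
  rw [← lintegral_add_right _ hfu, ← lintegral_const_mul' _ _ (by simp)]
  exact lintegral_mono fun w => hpt u w

/-- The constant in the local estimate of the Gagliardo seminorm by the energy. -/
def localConst (p q : ℝ) : ℝ≥0∞ :=
  ENNReal.ofReal (2 ^ q) * (2 * (4 * dilateConst q (3 * p - 2 * q - 1) * ENNReal.ofReal (32 ^ q)))

theorem localConst_ne_top {p q : ℝ} (hp : 2 / 3 * q + 1 < p) (hq : 0 < q) :
    localConst p q ≠ ⊤ := by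
  have := dilateConst_ne_top hq (by linarith : 1 < 3 * p - 2 * q - 1)
  unfold localConst
  finiteness

theorem TangentsClose.gagliardoLocal_le {p q δ : ℝ} (hp : 2 / 3 * q + 1 < p) (hq : 0 < q)
    (hδ : δ ≤ 1 / 2) (hP : TangentsClose γ δ) (hγ : IsC1Curve γ)
    (h1 : ∀ u, ‖curveDeriv γ u‖ = 1) :
    gagliardoLocal (3 * p - 2 * q - 1) q δ (curveDeriv γ) ≤
      localConst p q * mengerEnergy p q γ := by
  refine (gagliardoLocal_le_lintegral_secantDir _ δ hq hγ).trans ?_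
  rw [localConst, mul_assoc (ENNReal.ofReal (2 ^ q)), mul_assoc 2]
  gcongr
  exact hP.lintegral_secantDir_sub_le hp hq hδ hγ h1

end LocalEstimate

/-! ### A Morrey estimate for the Gagliardo integral -/

section Morrey

theorem setLIntegral_Ioo_zero_one_comp_mul {r : ℝ} (hr : 0 < r) (f : ℝ → ℝ≥0∞) :
    ∫⁻ t in Ioo 0 1, f (r * t) = ENNReal.ofReal r⁻¹ * ∫⁻ x in Ioo 0 r, f x := by
  have h := setLIntegral_preimage_div hr.ne' (measurableSet_Ioo (a := (0 : ℝ)) (b := 1)) f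
  rw [abs_of_pos hr] at h
  have e : (fun v : ℝ => v / r) ⁻¹' Ioo 0 1 = Ioo 0 r := by
    ext v
    simp [div_lt_one hr, hr]
  rw [e] at h
  simp_rw [mul_comm r]
  exact h

theorem setLIntegral_Ioo_comp_sub (w : ℝ) (f : ℝ → ℝ≥0∞) :
    ∫⁻ x in Ioo 0 w, f (w - x) = ∫⁻ x in Ioo 0 w, f x := by
  have := (Measure.measurePreserving_sub_left (volume : Measure ℝ) w).setLIntegral_comp_preimage_emb
    (MeasurableEquiv.subLeft w).measurableEmbedding f (Ioo 0 w)
  rw [← this]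
  simp

/-- A linear substitute for Hölder's inequality: the first summand suffices for `x ≤ ε`, the second
for `x ≥ ε`. The parameter `ε` stays free until the energy is known. -/
theorem le_add_rpow_mul {q x ε : ℝ} (hq : 1 < q) (hx : 0 ≤ x) (hε : 0 < ε) :
    x ≤ ε + ε ^ (1 - q) * x ^ q := by
  rcases le_total x ε with h | h
  · have := Real.rpow_nonneg hε.le (1 - q)
    have := Real.rpow_nonneg hx q
    nlinarith
  · have hx0 : 0 < x := hε.trans_le h
    have h2 : x ^ (1 - q) ≤ ε ^ (1 - q) := Real.rpow_le_rpow_of_nonpos hε h (by linarith)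
    have h3 : x = x ^ (1 - q) * x ^ q := by
      rw [← Real.rpow_add hx0, sub_add_cancel, Real.rpow_one]
    have h4 := Real.rpow_nonneg hx q
    nlinarith

variable {V : Type*} [NormedAddCommGroup V]

theorem edist_le_add_mul_quotient {q κ ε r : ℝ} (hq : 1 < q) (hκ : 0 < κ) (hε : 0 < ε)
    (hr : 0 < r) {G : ℝ → V} {a b : ℝ} (hab : |a - b| ≤ r) :
    edist (G a) (G b) ≤ ENNReal.ofReal (r ^ ((κ - 2) / q)) * (ENNReal.ofReal ε +
      ENNReal.ofReal (r ^ 2 * ε ^ (1 - q)) *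
        ENNReal.ofReal (‖G a - G b‖ ^ q / |a - b| ^ κ)) := by
  rcases eq_or_ne a b with rfl | hne
  · simp
  have hab0 : 0 < |a - b| := abs_pos.2 (sub_ne_zero.2 hne)
  rw [edist_dist, dist_eq_norm, ← ENNReal.ofReal_mul (by positivity),
    ← ENNReal.ofReal_add (by positivity) (by positivity), ← ENNReal.ofReal_mul (by positivity)]
  refine ENNReal.ofReal_le_ofReal ?_
  set x := ‖G a - G b‖
  have hx : 0 ≤ x := norm_nonneg _
  -- The threshold is scaled so that both terms carry the same factor `r^((κ-2)/q)`; the remaining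
  -- `r^2` later cancels the Jacobian of a double mean.
  have h1 := le_add_rpow_mul (ε := ε * r ^ ((κ - 2) / q)) hq hx (by positivity)
  refine h1.trans ?_
  rw [mul_add, mul_comm ε]
  refine add_le_add le_rfl ?_
  have h2 : |a - b| ^ κ ≤ r ^ κ := by gcongr
  have h3 : x ^ q ≤ r ^ κ * (x ^ q / |a - b| ^ κ) := by
    rw [mul_div_assoc', le_div_iff₀ (by positivity), mul_comm]
    gcongr
  calc (r ^ ((κ - 2) / q) * ε) ^ (1 - q) * x ^ q
      ≤ (r ^ ((κ - 2) / q) * ε) ^ (1 - q) * (r ^ κ * (x ^ q / |a - b| ^ κ)) := by gcongr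
    _ = (r ^ ((κ - 2) / q * (1 - q)) * r ^ κ) * ε ^ (1 - q) * (x ^ q / |a - b| ^ κ) := by
      rw [Real.mul_rpow (by positivity) hε.le, ← Real.rpow_mul hr.le]
      ring
    _ = (r ^ ((κ - 2) / q) * r ^ 2) * ε ^ (1 - q) * (x ^ q / |a - b| ^ κ) := by
      rw [← Real.rpow_add hr, ← Real.rpow_natCast r 2, ← Real.rpow_add hr]
      congr 3
      push_cast
      field_simp
      ring
    _ = _ := by ring

/-- The mean distance of `G 0` to the values of `G` on `(0, r)`. -/
def meanDist (G : ℝ → V) (r : ℝ) : ℝ≥0∞ := ∫⁻ t in Ioo (0 : ℝ) 1, edist (G 0) (G (r * t))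

/-- Insert a point of `(0, r/2)` between `G 0` and a point of `(0, r)`, then average over both. -/
theorem meanDist_le_half {q κ ε r w : ℝ} (hq : 1 < q) (hκ : 0 < κ) (hε : 0 < ε)
    (hr : 0 < r) (hrw : r ≤ w) {G : ℝ → V} (hG : Continuous G) :
    meanDist G r ≤ meanDist G (r / 2) + ENNReal.ofReal (r ^ ((κ - 2) / q)) * (ENNReal.ofReal ε +
      2 * ENNReal.ofReal (ε ^ (1 - q)) * ∫⁻ a in Ioo 0 w, ∫⁻ b in Ioo 0 w,
        ENNReal.ofReal (‖G a - G b‖ ^ q / |a - b| ^ κ)) := by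
  obtain ⟨k, hk⟩ : ∃ k : ℝ → ℝ → ℝ≥0∞, k = fun a b =>
    ENNReal.ofReal (‖G a - G b‖ ^ q / |a - b| ^ κ) := ⟨_, rfl⟩
  set A := ∫⁻ a in Ioo 0 w, ∫⁻ b in Ioo 0 w,
        ENNReal.ofReal (‖G a - G b‖ ^ q / |a - b| ^ κ)
  have hA : ∫⁻ t in Ioo (0 : ℝ) 1, ∫⁻ t' in Ioo (0 : ℝ) 1, k (r * t) (r / 2 * t') ≤
      ENNReal.ofReal (2 / r ^ 2) * A := by
    have h1 : ∀ a, ∫⁻ t' in Ioo (0 : ℝ) 1, k a (r / 2 * t') ≤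
        ENNReal.ofReal (r / 2)⁻¹ * ∫⁻ b in Ioo 0 w, k a b := by
      intro a
      rw [setLIntegral_Ioo_zero_one_comp_mul (by positivity)]
      gcongr
      linarith
    calc _ ≤ ∫⁻ t in Ioo (0 : ℝ) 1, ENNReal.ofReal (r / 2)⁻¹ * ∫⁻ b in Ioo 0 w, k (r * t) b :=
          lintegral_mono fun t => h1 _
      _ = ENNReal.ofReal (r / 2)⁻¹ * (ENNReal.ofReal r⁻¹ *
            ∫⁻ a in Ioo 0 r, ∫⁻ b in Ioo 0 w, k a b) := by
          rw [lintegral_const_mul' _ _ (by simp),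
            setLIntegral_Ioo_zero_one_comp_mul hr (fun a => ∫⁻ b in Ioo 0 w, k a b)]
      _ ≤ ENNReal.ofReal (r / 2)⁻¹ * (ENNReal.ofReal r⁻¹ * A) := by
          have : A = ∫⁻ a in Ioo 0 w, ∫⁻ b in Ioo 0 w, k a b := by rw [hk]
          rw [this]
          gcongr
      _ = _ := by
          rw [← mul_assoc, ← ENNReal.ofReal_mul (by positivity)]
          congr 2
          field_simp
  have hkm : ∀ a, Measurable fun t' => k a (r / 2 * t') := by
    intro a
    rw [hk]
    have h1 : Continuous fun t' => ‖G a - G (r / 2 * t')‖ := by fun_prop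
    have h2 : Continuous fun t' => |a - r / 2 * t'| := by fun_prop
    exact ((h1.measurable.pow_const q).div (h2.measurable.pow_const κ)).ennreal_ofReal
  have hconst : ∀ c : ℝ≥0∞, ∫⁻ _ in Ioo (0 : ℝ) 1, c = c := by simp
  have hm1 : Measurable fun t' => edist (G 0) (G (r / 2 * t')) := by
    have : Continuous fun t' => edist (G 0) (G (r / 2 * t')) := by fun_prop
    exact this.measurable
  have hpt : ∀ t ∈ Ioo (0 : ℝ) 1, edist (G 0) (G (r * t)) ≤ meanDist G (r / 2) +
      ENNReal.ofReal (r ^ ((κ - 2) / q)) * (ENNReal.ofReal ε +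
      ENNReal.ofReal (r ^ 2 * ε ^ (1 - q)) * ∫⁻ t' in Ioo (0 : ℝ) 1, k (r * t) (r / 2 * t')) := by
    intro t ht
    rw [← hconst (edist (G 0) (G (r * t)))]
    calc _ ≤ ∫⁻ t' in Ioo (0 : ℝ) 1, (edist (G 0) (G (r / 2 * t')) +
          ENNReal.ofReal (r ^ ((κ - 2) / q)) * (ENNReal.ofReal ε +
          ENNReal.ofReal (r ^ 2 * ε ^ (1 - q)) * k (r * t) (r / 2 * t'))) := by
          refine setLIntegral_mono' measurableSet_Ioo fun t' ht' => ?_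
          refine (edist_triangle _ (G (r / 2 * t')) _).trans ?_
          gcongr
          rw [edist_comm, hk]
          refine edist_le_add_mul_quotient hq hκ hε hr ?_
          rw [abs_le]
          constructor <;> nlinarith [ht.1, ht.2, ht'.1, ht'.2]
      _ = _ := by
          rw [lintegral_add_left hm1, lintegral_const_mul' _ _ (by simp),
            lintegral_add_left measurable_const, lintegral_const_mul' _ _ (by simp), hconst]
          rfl
  calc meanDist G r ≤ ∫⁻ t in Ioo (0 : ℝ) 1, (meanDist G (r / 2) +
      ENNReal.ofReal (r ^ ((κ - 2) / q)) * (ENNReal.ofReal ε +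
      ENNReal.ofReal (r ^ 2 * ε ^ (1 - q)) *
        ∫⁻ t' in Ioo (0 : ℝ) 1, k (r * t) (r / 2 * t'))) :=
        setLIntegral_mono' measurableSet_Ioo hpt
    _ = meanDist G (r / 2) + ENNReal.ofReal (r ^ ((κ - 2) / q)) * (ENNReal.ofReal ε +
      ENNReal.ofReal (r ^ 2 * ε ^ (1 - q)) *
        ∫⁻ t in Ioo (0 : ℝ) 1, ∫⁻ t' in Ioo (0 : ℝ) 1, k (r * t) (r / 2 * t')) := by
        rw [lintegral_add_left measurable_const, lintegral_const_mul' _ _ (by simp),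
            lintegral_add_left measurable_const, lintegral_const_mul' _ _ (by simp), hconst, hconst]
    _ ≤ meanDist G (r / 2) + ENNReal.ofReal (r ^ ((κ - 2) / q)) * (ENNReal.ofReal ε +
      ENNReal.ofReal (r ^ 2 * ε ^ (1 - q)) * (ENNReal.ofReal (2 / r ^ 2) * A)) := by gcongr
    _ = _ := by
        rw [← mul_assoc (ENNReal.ofReal (r ^ 2 * _)), ← ENNReal.ofReal_mul (by positivity)]
        have : r ^ 2 * ε ^ (1 - q) * (2 / r ^ 2) = 2 * ε ^ (1 - q) := by field_simp
        rw [this, ENNReal.ofReal_mul two_pos.le, ENNReal.ofReal_ofNat]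

theorem tendsto_meanDist {G : ℝ → V} (hG : Continuous G) (w : ℝ) :
    Filter.Tendsto (fun N : ℕ => meanDist G (w / 2 ^ N)) Filter.atTop (nhds 0) := by
  rw [ENNReal.tendsto_atTop_zero]
  intro η hη
  have h0 : Filter.Tendsto (fun x => edist (G 0) (G x)) (nhds 0) (nhds 0) := by
    have : Continuous fun x => edist (G 0) (G x) := by fun_prop
    simpa using this.tendsto 0
  obtain ⟨ρ, hρ, h⟩ := Metric.eventually_nhds_iff.1 (h0.eventually (ge_mem_nhds hη))
  have h1 : Filter.Tendsto (fun N : ℕ => |w| / 2 ^ N) Filter.atTop (nhds 0) :=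
    tendsto_const_nhds.div_atTop (tendsto_pow_atTop_atTop_of_one_lt one_lt_two)
  obtain ⟨N, hN⟩ := Filter.eventually_atTop.1 (h1.eventually (gt_mem_nhds hρ))
  refine ⟨N, fun k hk => ?_⟩
  have hc : ∫⁻ _ in Ioo (0 : ℝ) 1, η = η := by simp
  rw [← hc]
  refine setLIntegral_mono' measurableSet_Ioo fun t ht => h ?_
  rw [Real.dist_eq, sub_zero, abs_mul, abs_div, abs_of_pos ht.1, abs_of_pos (by positivity :
    (0 : ℝ) < 2 ^ k)]
  have := hN k hk
  have h3 : 0 ≤ |w| / 2 ^ k := by positivity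
  nlinarith [ht.1, ht.2]

/-- The geometric series `∑ 2 ^ (-α k)`. -/
def geomConst (α : ℝ) : ℝ≥0∞ := (1 - ENNReal.ofReal ((1 / 2) ^ α))⁻¹

theorem geomConst_ne_top {α : ℝ} (hα : 0 < α) : geomConst α ≠ ⊤ := by
  refine ENNReal.inv_ne_top.2 (tsub_pos_of_lt ?_).ne'
  rw [ENNReal.ofReal_lt_one]
  exact Real.rpow_lt_one (by norm_num) (by norm_num) hα

/-- Halve the interval repeatedly: continuity kills the mean in the limit, and the errors form a
geometric series of ratio `2^(-(κ-2)/q)`. -/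
theorem meanDist_le {q κ ε w : ℝ} (hq : 1 < q) (hκ : 0 < κ) (hε : 0 < ε)
    (hw : 0 < w) {G : ℝ → V} (hG : Continuous G) :
    meanDist G w ≤ ENNReal.ofReal (w ^ ((κ - 2) / q)) * (ENNReal.ofReal ε +
      2 * ENNReal.ofReal (ε ^ (1 - q)) * ∫⁻ a in Ioo 0 w, ∫⁻ b in Ioo 0 w,
        ENNReal.ofReal (‖G a - G b‖ ^ q / |a - b| ^ κ)) * geomConst ((κ - 2) / q) := by
  set H := ENNReal.ofReal ε + 2 * ENNReal.ofReal (ε ^ (1 - q)) * ∫⁻ a in Ioo 0 w, ∫⁻ b in Ioo 0 w,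
        ENNReal.ofReal (‖G a - G b‖ ^ q / |a - b| ^ κ)
  set α := (κ - 2) / q
  set θ := ENNReal.ofReal ((1 / 2) ^ α)
  have hstep : ∀ N : ℕ, meanDist G w ≤ meanDist G (w / 2 ^ N) +
      ∑ k ∈ Finset.range N, ENNReal.ofReal (w ^ α) * H * θ ^ k := by
    intro N
    induction N with
    | zero => simp
    | succ N ih =>
      rw [Finset.sum_range_succ, add_comm (∑ k ∈ _, _), ← add_assoc]
      refine ih.trans ?_
      gcongr
      have h2 : (1 : ℝ) ≤ 2 ^ N := one_le_pow₀ one_le_two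
      have h := meanDist_le_half hq hκ hε (r := w / 2 ^ N) (w := w) (by positivity)
        (div_le_self hw.le h2) hG
      rw [div_div, ← pow_succ] at h
      have e : ENNReal.ofReal ((w / 2 ^ N) ^ α) = ENNReal.ofReal (w ^ α) * θ ^ N := by
        rw [← ENNReal.ofReal_pow (by positivity), ← ENNReal.ofReal_mul (by positivity),
          div_eq_mul_inv, Real.mul_rpow hw.le (by positivity), ← inv_pow, Real.rpow_pow_comm
            (by norm_num)]
        norm_num
      refine h.trans (le_of_eq ?_)
      rw [mul_right_comm (ENNReal.ofReal (w ^ α)), ← e]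
  have hsum : ∀ N : ℕ, meanDist G w ≤ meanDist G (w / 2 ^ N) +
      ENNReal.ofReal (w ^ α) * H * geomConst α := by
    intro N
    refine (hstep N).trans ?_
    gcongr
    refine (ENNReal.sum_le_tsum _).trans ?_
    rw [ENNReal.tsum_mul_left, ENNReal.tsum_geometric]
    rfl
  have hl := (tendsto_meanDist hG w).add_const (ENNReal.ofReal (w ^ α) * H * geomConst α)
  rw [zero_add] at hl
  exact ge_of_tendsto' hl hsum

/-- Compare `G 0` and `G w` with the values on `(0, w)`; reflecting the interval turns the bound at
`0` into the one at `w`. -/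
theorem edist_le_morrey {q κ ε w : ℝ} (hq : 1 < q) (hκ : 0 < κ) (hε : 0 < ε)
    (hw : 0 < w) {G : ℝ → V} (hG : Continuous G) :
    edist (G 0) (G w) ≤ 2 * (ENNReal.ofReal (w ^ ((κ - 2) / q)) * (ENNReal.ofReal ε +
      2 * ENNReal.ofReal (ε ^ (1 - q)) * ∫⁻ a in Ioo 0 w, ∫⁻ b in Ioo 0 w,
        ENNReal.ofReal (‖G a - G b‖ ^ q / |a - b| ^ κ)) * geomConst ((κ - 2) / q)) := by
  have hG' : Continuous fun x => G (w - x) := by fun_prop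
  have h1 := meanDist_le hq hκ hε hw hG
  have h2 := meanDist_le hq hκ hε hw hG'
  have e1 : ∫⁻ a in Ioo 0 w, ∫⁻ b in Ioo 0 w,
      ENNReal.ofReal (‖G (w - a) - G (w - b)‖ ^ q / |a - b| ^ κ) =
      ∫⁻ a in Ioo 0 w, ∫⁻ b in Ioo 0 w, ENNReal.ofReal (‖G a - G b‖ ^ q / |a - b| ^ κ) := by
    rw [← setLIntegral_Ioo_comp_sub w (fun a => ∫⁻ b in Ioo 0 w,
      ENNReal.ofReal (‖G a - G b‖ ^ q / |a - b| ^ κ))]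
    refine lintegral_congr fun a => ?_
    rw [← setLIntegral_Ioo_comp_sub w (fun b =>
      ENNReal.ofReal (‖G (w - a) - G b‖ ^ q / |w - a - b| ^ κ))]
    refine lintegral_congr fun b => ?_
    rw [sub_sub_sub_cancel_left, abs_sub_comm]
  rw [e1] at h2
  have e2 : meanDist (fun x => G (w - x)) w = ∫⁻ t in Ioo (0 : ℝ) 1, edist (G w) (G (w * t)) := by
    rw [← setLIntegral_Ioo_comp_sub 1 (fun t => edist (G w) (G (w * t)))]
    simp only [meanDist, sub_zero, mul_sub, mul_one]
  rw [e2] at h2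
  have hc : ∀ c : ℝ≥0∞, ∫⁻ _ in Ioo (0 : ℝ) 1, c = c := by simp
  rw [two_mul, ← hc (edist (G 0) (G w))]
  refine le_trans ?_ (add_le_add h1 h2)
  have hm : Continuous fun t => edist (G 0) (G (w * t)) := by fun_prop
  rw [meanDist, ← lintegral_add_left hm.measurable]
  exact lintegral_mono fun t => (edist_triangle_right _ _ _)

variable {n : ℕ}

theorem edist_le_gagliardoLocal {q κ ε δ : ℝ} (hq : 1 < q) (hκ : 0 < κ) (hε : 0 < ε)
    (hδ : δ ≤ 1) {g : UnitAddCircle → EuclideanSpace ℝ (Fin n)} (hg : Continuous g)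
    (u : UnitAddCircle) {w : ℝ} (hw : |w| < δ) :
    edist (g (u + (w : UnitAddCircle))) (g u) ≤
      2 * (ENNReal.ofReal (|w| ^ ((κ - 2) / q)) * (ENNReal.ofReal ε +
      2 * ENNReal.ofReal (ε ^ (1 - q)) * gagliardoLocal κ q δ g) * geomConst ((κ - 2) / q)) := by
  wlog hw0 : 0 < w generalizing u w
  · rcases eq_or_ne w 0 with rfl | hne
    · simp
    · have := this (u + (w : UnitAddCircle)) (w := -w) (by rwa [abs_neg])
        (by rcases lt_or_gt_of_ne hne with h | h <;> [linarith; exact absurd h hw0])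
      rw [AddCircle.coe_neg, add_neg_cancel_right, edist_comm, abs_neg] at this
      exact this
  rw [abs_of_pos hw0] at hw ⊢
  have hc : Continuous (fun x : ℝ => (x : UnitAddCircle)) := AddCircle.continuous_mk' 1
  have hG : Continuous fun t : ℝ => g (u + (t : UnitAddCircle)) := by fun_prop
  have h := edist_le_morrey hq hκ hε hw0 hG
  simp only [AddCircle.coe_zero, add_zero] at h
  rw [edist_comm]
  refine h.trans ?_
  gcongr
  set Φ : UnitAddCircle → ℝ≥0∞ := fun u => ∫⁻ w : ℝ in Ioo (-δ) δ,
    ENNReal.ofReal (‖g (u + (w : UnitAddCircle)) - g u‖ ^ q / |w| ^ κ)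
  calc _ ≤ ∫⁻ a in Ioo 0 w, Φ (u + (a : UnitAddCircle)) := by
        refine setLIntegral_mono' measurableSet_Ioo fun a ha => ?_
        rw [← lintegral_indicator measurableSet_Ioo,
          ← lintegral_add_left_eq_self _ a]
        simp only [Φ]
        rw [← lintegral_indicator measurableSet_Ioo]
        refine lintegral_mono fun z => ?_
        by_cases hz : a + z ∈ Ioo 0 w
        · have hz' : z ∈ Ioo (-δ) δ := by
            constructor <;> linarith [hz.1, hz.2, ha.1, ha.2]
          simp only [indicator_of_mem hz, indicator_of_mem hz']
          rw [sub_add_cancel_left, abs_neg, norm_sub_rev, AddCircle.coe_add, add_assoc]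
        · simp [indicator_of_notMem hz]
    -- Here `w < δ ≤ 1`, so `(0, w)` lies in a single period.
    _ ≤ ∫⁻ a : ℝ in Ioc 0 (0 + 1), Φ (u + (a : UnitAddCircle)) := by
        refine lintegral_mono_set fun a ha => ⟨ha.1, ?_⟩
        linarith [ha.2]
    _ = _ := by
        rw [UnitAddCircle.lintegral_preimage 0 (fun x => Φ (u + x)), lintegral_add_left_eq_self]
        rfl

end Morrey

/-! ### A scale depending only on the energy -/

section Quantitative

variable {n : ℕ} {γ : UnitAddCircle → EuclideanSpace ℝ (Fin n)}

theorem UnitAddCircle.exists_coe_eq (x : UnitAddCircle) :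
    ∃ w : ℝ, |w| ≤ 1 / 2 ∧ (w : UnitAddCircle) = x ∧ ‖x‖ = |w| := by
  induction x using QuotientAddGroup.induction_on with
  | H t =>
    refine ⟨t - round t, abs_sub_round t, ?_, UnitAddCircle.norm_eq⟩
    have h : ((round t : ℝ) : UnitAddCircle) = 0 := by
      rw [AddCircle.coe_eq_zero_iff]
      exact ⟨round t, by simp⟩
    rw [AddCircle.coe_sub, h, sub_zero]

theorem UnitAddCircle.norm_coe_le (w : ℝ) : ‖(w : UnitAddCircle)‖ ≤ |w| := by
  rw [UnitAddCircle.norm_eq]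
  simpa using round_le w 0

theorem IsC1Curve.exists_tangentsClose_half (hγ : IsC1Curve γ) : ∃ η : ℝ, 0 < η ∧
    ∀ (u : UnitAddCircle) (w : ℝ), |w| < η →
      ‖curveDeriv γ (u + (w : UnitAddCircle)) - curveDeriv γ u‖ ≤ 1 / 2 := by
  have h := CompactSpace.uniformContinuous_of_continuous hγ.continuous_curveDeriv
  obtain ⟨η, hη, h2⟩ := Metric.uniformContinuous_iff.1 h (1 / 2) (by norm_num)
  refine ⟨η, hη, fun u w hw => ?_⟩
  rw [← dist_eq_norm]
  refine (h2 ?_).le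
  rw [dist_eq_norm, add_sub_cancel_left]
  exact (UnitAddCircle.norm_coe_le w).trans_lt hw

theorem one_le_geomConst (α : ℝ) : 1 ≤ geomConst α := by
  rw [geomConst, ENNReal.one_le_inv]
  exact tsub_le_self

/-- The energy of a curve times this constant controls the scale on which its tangents are
close. -/
def scaleConst (p q : ℝ) : ℝ :=
  2 * (8 * (geomConst ((3 * p - 2 * q - 1 - 2) / q)).toReal) ^ q * ((localConst p q).toReal + 1)

theorem scaleConst_pos {p q : ℝ} (hq : 0 < q) (hp : 2 / 3 * q + 1 < p) : 0 < scaleConst p q := by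
  have h1 := geomConst_ne_top (α := (3 * p - 2 * q - 1 - 2) / q) (div_pos (by linarith) hq)
  have h2 : 0 < (geomConst ((3 * p - 2 * q - 1 - 2) / q)).toReal :=
    ENNReal.toReal_pos (zero_lt_one.trans_le (one_le_geomConst _)).ne' h1
  unfold scaleConst
  positivity

/-- Closeness with bound `1` bounds the seminorm by the energy, and Morrey's estimate returns the
bound `1/2` at the same scale. This gain drives the continuity argument. -/
theorem TangentsClose.norm_sub_le_half {p q δ t : ℝ} (hp : 2 / 3 * q + 1 < p) (hq : 1 < q)
    (hδ0 : 0 < δ) (hδ : δ ≤ 1 / 2) (ht : t ≤ δ) (hγ : IsC1Curve γ)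
    (h1 : ∀ u, ‖curveDeriv γ u‖ = 1) (hE : mengerEnergy p q γ ≠ ⊤)
    (hδE : δ ^ (3 * p - 2 * q - 1 - 2) * (scaleConst p q * (mengerEnergy p q γ).toReal) ≤ 1)
    (hP : TangentsClose γ t) (u : UnitAddCircle) {w : ℝ} (hw : |w| < t) :
    ‖curveDeriv γ (u + (w : UnitAddCircle)) - curveDeriv γ u‖ ≤ 1 / 2 := by
  set κ := 3 * p - 2 * q - 1 with hκ
  have hq0 : 0 < q := by linarith
  set α := (κ - 2) / q with hα
  have hα0 : 0 < α := div_pos (by linarith) hq0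
  set M := (geomConst α).toReal with hM
  have hMt := geomConst_ne_top hα0
  have hM0 : 0 < M := ENNReal.toReal_pos (zero_lt_one.trans_le (one_le_geomConst _)).ne' hMt
  have hLt := localConst_ne_top hp hq0
  set L := (localConst p q).toReal with hL
  have hL0 : 0 ≤ L := ENNReal.toReal_nonneg
  set e := (mengerEnergy p q γ).toReal with he
  have he0 : 0 ≤ e := ENNReal.toReal_nonneg
  -- With `ε = D⁻¹`, `hδE` makes the energy term at most `ε`, and the final bound `4 δ^α M / D`
  -- equals `1/2`.
  set D := 8 * (δ ^ α * M) with hD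
  have hD0 : 0 < D := by positivity
  have h := edist_le_gagliardoLocal (κ := κ) hq (by linarith) (inv_pos.2 hD0)
    (by linarith : t ≤ 1) hγ.continuous_curveDeriv u hw
  have hS := hP.gagliardoLocal_le hp hq0 (ht.trans hδ) hγ h1
  rw [← hκ] at hS
  have hwδ : |w| ^ α ≤ δ ^ α := by
    have := hw.le.trans ht
    gcongr
  have h2 : edist (curveDeriv γ (u + (w : UnitAddCircle))) (curveDeriv γ u) ≤
      ENNReal.ofReal (2 * (δ ^ α * (D⁻¹ + 2 * D⁻¹ ^ (1 - q) * (L * e)) * M)) := by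
    refine h.trans ?_
    rw [ENNReal.ofReal_mul two_pos.le, ENNReal.ofReal_mul (by positivity),
      ENNReal.ofReal_mul (by positivity), ENNReal.ofReal_add (by positivity) (by positivity),
      ENNReal.ofReal_mul (by positivity), ENNReal.ofReal_mul two_pos.le, ENNReal.ofReal_mul hL0,
      ENNReal.ofReal_ofNat, hL, he, hM, ENNReal.ofReal_toReal hE, ENNReal.ofReal_toReal hLt,
      ENNReal.ofReal_toReal hMt]
    gcongr
  rw [edist_dist, dist_eq_norm] at h2
  refine ((ENNReal.ofReal_le_ofReal_iff (by positivity)).1 h2).trans ?_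
  have h3 : D⁻¹ ^ (1 - q) = D⁻¹ * D ^ q := by
    rw [Real.rpow_sub (inv_pos.2 hD0), Real.rpow_one, Real.inv_rpow hD0.le, div_inv_eq_mul]
  have h4 : D ^ q = (8 * M) ^ q * δ ^ (κ - 2) := by
    rw [hD, mul_left_comm, mul_comm, Real.mul_rpow (by positivity) (by positivity),
      ← Real.rpow_mul hδ0.le, hα, div_mul_cancel₀ _ hq0.ne']
  have h5 : 2 * D ^ q * (L * e) ≤ 1 := by
    rw [h4]
    refine le_trans ?_ hδE
    rw [scaleConst, ← hκ, ← hα, ← hM, ← hL]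
    have : 0 ≤ 2 * (8 * M) ^ q * δ ^ (κ - 2) * e := by positivity
    nlinarith
  have h6 : D⁻¹ + 2 * D⁻¹ ^ (1 - q) * (L * e) ≤ 2 * D⁻¹ := by
    rw [h3]
    have := inv_pos.2 hD0
    nlinarith
  calc _ ≤ 2 * (δ ^ α * (2 * D⁻¹) * M) := by gcongr
    _ = _ := by
      rw [hD]
      field_simp
      norm_num

/-- Uniform continuity gives a step `η` that depends on `γ`. Each induction step enlarges the scale
by `η`, using the improved bound `1/2` on the old scale and `1/2` for the remainder, until `δ` is
reached. -/
theorem tangentsClose_of_energy {p q δ : ℝ} (hp : 2 / 3 * q + 1 < p) (hq : 1 < q)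
    (hδ0 : 0 < δ) (hδ : δ ≤ 1 / 2) (hγ : IsC1Curve γ)
    (h1 : ∀ u, ‖curveDeriv γ u‖ = 1) (hE : mengerEnergy p q γ ≠ ⊤)
    (hδE : δ ^ (3 * p - 2 * q - 1 - 2) * (scaleConst p q * (mengerEnergy p q γ).toReal) ≤ 1) :
    TangentsClose γ δ := by
  obtain ⟨η, hη, hclose⟩ := hγ.exists_tangentsClose_half
  have hind : ∀ k : ℕ, TangentsClose γ (min ((k + 1) * η) δ) := by
    intro k
    induction k with
    | zero =>
      intro u w hw
      have : |w| < η := by simpa using hw.trans_le (min_le_left _ _)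
      linarith [hclose u w this]
    | succ k ih =>
      intro u w hw
      obtain ⟨hw1, hw2⟩ := lt_min_iff.1 hw
      push_cast at hw1
      -- Splits a displacement shorter than `(k+2)η` into one shorter than `(k+1)η` and one shorter
      -- than `η`.
      set c : ℝ := (k + 1) / (k + 2) with hc
      have hc0 : 0 < c := by positivity
      have hc1 : c ≤ 1 := by
        rw [hc, div_le_one (by positivity)]
        linarith
      have hcw : |c * w| < min ((k + 1) * η) δ := by
        rw [abs_mul, abs_of_pos hc0]
        refine lt_min ?_ ((mul_le_of_le_one_left (abs_nonneg _) hc1).trans_lt hw2)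
        rw [hc, div_mul_eq_mul_div, div_lt_iff₀ (by positivity)]
        nlinarith [(by positivity : (0 : ℝ) < k + 1)]
      have hrest : |w - c * w| < η := by
        rw [← one_sub_mul, abs_mul, abs_of_nonneg (by linarith),
          show 1 - c = 1 / (k + 2) by rw [hc]; field_simp; ring, div_mul_eq_mul_div,
          div_lt_iff₀ (by positivity)]
        linarith
      have h2 := ih.norm_sub_le_half hp hq hδ0 hδ (min_le_right _ _) hγ h1 hE hδE u hcw
      have h3 := hclose (u + ((c * w : ℝ) : UnitAddCircle)) _ hrest
      rw [add_assoc, ← AddCircle.coe_add, add_sub_cancel] at h3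
      refine (norm_sub_le_norm_sub_add_norm_sub _
        (curveDeriv γ (u + ((c * w : ℝ) : UnitAddCircle))) _).trans ?_
      linarith
  obtain ⟨k, hk⟩ := exists_nat_gt (δ / η)
  have : min ((k + 1) * η) δ = δ := by
    rw [div_lt_iff₀ hη] at hk
    exact min_eq_right (by nlinarith)
  exact this ▸ hind k

/-- The component of the curve along `γ'(0)` agrees at `±1/2`, so by Rolle some tangent in between
is orthogonal to `γ'(0)`. -/
theorem not_tangentsClose_half (hγ : IsC1Curve γ) (h1 : ∀ u, ‖curveDeriv γ u‖ = 1) :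
    ¬ TangentsClose γ (1 / 2) := by
  intro hP
  have hd : ∀ t : ℝ, HasDerivAt (fun t : ℝ =>
      inner ℝ (curveDeriv γ 0) (γ (0 + (t : UnitAddCircle))))
      (inner ℝ (curveDeriv γ 0) (curveDeriv γ (0 + (t : UnitAddCircle)))) t := by
    intro t
    have h2 := ((hasDerivAt_const t (curveDeriv γ 0)).inner ℝ (hγ.hasDerivAt 0 t))
    rwa [inner_zero_left, add_zero] at h2
  obtain ⟨t, ht, e⟩ := exists_hasDerivAt_eq_slope _ _ (by norm_num : (-(1 / 2) : ℝ) < 1 / 2)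
    (fun x _ => (hd x).continuousAt.continuousWithinAt) (fun x _ => hd x)
  have e2 : (((1 / 2 : ℝ)) : UnitAddCircle) = ((-(1 / 2) : ℝ) : UnitAddCircle) := by
    rw [← sub_eq_zero, ← AddCircle.coe_sub, AddCircle.coe_eq_zero_iff]
    exact ⟨1, by norm_num⟩
  rw [e2, sub_self, zero_div] at e
  have h2 := hP.half_le_inner h1 0 (v := 0) (w := t) (by rw [zero_sub, abs_neg]; exact abs_lt.2 ht)
  rw [AddCircle.coe_zero, add_zero, e] at h2
  norm_num at h2

theorem one_lt_energy {p q : ℝ} (hp : 2 / 3 * q + 1 < p) (hq : 1 < q) (hγ : IsC1Curve γ)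
    (h1 : ∀ u, ‖curveDeriv γ u‖ = 1) (hE : mengerEnergy p q γ ≠ ⊤) :
    1 < (1 / 2) ^ (3 * p - 2 * q - 1 - 2) * (scaleConst p q * (mengerEnergy p q γ).toReal) := by
  by_contra! h
  exact not_tangentsClose_half hγ h1
    (tangentsClose_of_energy hp hq (by norm_num) le_rfl hγ h1 hE h)

/-- Beyond distance `δ`, unit vectors differ by at most `2` and the weight is at most `δ^(-κ)`, on
an interval of length one. -/
theorem gagliardoLocal_half_le (κ : ℝ) {q δ : ℝ} (hq : 0 < q) (hκ : 0 < κ) (hδ0 : 0 < δ)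
    {g : UnitAddCircle → EuclideanSpace ℝ (Fin n)} (hg : ∀ u, ‖g u‖ = 1) :
    gagliardoLocal κ q (1 / 2) g ≤
      gagliardoLocal κ q δ g + ENNReal.ofReal (2 ^ q / δ ^ κ) := by
  have hu : ∀ u : UnitAddCircle, ∫⁻ w : ℝ in Ioo (-(1 / 2)) (1 / 2),
      ENNReal.ofReal (‖g (u + (w : UnitAddCircle)) - g u‖ ^ q / |w| ^ κ) ≤
      (∫⁻ w : ℝ in Ioo (-δ) δ,
        ENNReal.ofReal (‖g (u + (w : UnitAddCircle)) - g u‖ ^ q / |w| ^ κ)) +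
      ENNReal.ofReal (2 ^ q / δ ^ κ) := by
    intro u
    calc _ ≤ ∫⁻ w : ℝ in Ioo (-(1 / 2)) (1 / 2), ((Ioo (-δ) δ).indicator (fun w : ℝ =>
          ENNReal.ofReal (‖g (u + (w : UnitAddCircle)) - g u‖ ^ q / |w| ^ κ)) w +
          ENNReal.ofReal (2 ^ q / δ ^ κ)) := by
          refine lintegral_mono fun w => ?_
          by_cases hw : w ∈ Ioo (-δ) δ
          · rw [indicator_of_mem hw]
            exact le_self_add
          · rw [indicator_of_notMem hw, zero_add]
            rw [mem_Ioo, ← abs_lt, not_lt] at hw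
            refine ENNReal.ofReal_le_ofReal ?_
            gcongr
            refine (norm_sub_le _ _).trans ?_
            rw [hg, hg]
            norm_num
      _ = (∫⁻ w : ℝ in Ioo (-(1 / 2)) (1 / 2), (Ioo (-δ) δ).indicator (fun w : ℝ =>
          ENNReal.ofReal (‖g (u + (w : UnitAddCircle)) - g u‖ ^ q / |w| ^ κ)) w) +
          ENNReal.ofReal (2 ^ q / δ ^ κ) := by
          rw [lintegral_add_right _ measurable_const, setLIntegral_const, Real.volume_Ioo]
          norm_num
      _ ≤ _ := by
          exact add_le_add ((setLIntegral_le_lintegral _ _).trans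
            (lintegral_indicator measurableSet_Ioo _).le) le_rfl
  refine (lintegral_mono hu).trans (le_of_eq ?_)
  rw [lintegral_add_right _ measurable_const, lintegral_const, UnitAddCircle.measure_univ, mul_one]
  rfl

theorem gagliardoLocal_half_le_of_energy {p q : ℝ} (hp : 2 / 3 * q + 1 < p) (hq : 1 < q) (hγ : IsC1Curve γ)
    (h1 : ∀ u, ‖curveDeriv γ u‖ = 1) (hE : mengerEnergy p q γ ≠ ⊤) :
    gagliardoLocal (3 * p - 2 * q - 1) q (1 / 2) (curveDeriv γ) ≤
      ENNReal.ofReal ((localConst p q).toReal * (mengerEnergy p q γ).toReal +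
        2 ^ q * (scaleConst p q * (mengerEnergy p q γ).toReal) ^
          ((3 * p - 2 * q - 1) / (3 * p - 2 * q - 1 - 2))) := by
  set κ := 3 * p - 2 * q - 1 with hκ
  have hlow := one_lt_energy hp hq hγ h1 hE
  rw [← hκ] at hlow
  set x := scaleConst p q * (mengerEnergy p q γ).toReal with hx
  have hκ2 : 0 < κ - 2 := by linarith
  have hx0 : 0 < x := by
    by_contra! h
    have : 0 ≤ ((1 : ℝ) / 2) ^ (κ - 2) := by positivity
    nlinarith
  -- The largest scale allowed by `tangentsClose_of_energy`; the lower bound on the energy ensures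
  -- `δ ≤ 1/2`.
  set δ := x ^ (-(1 / (κ - 2))) with hδ
  have hδ0 : 0 < δ := by positivity
  have hδx : δ ^ (κ - 2) * x = 1 := by
    rw [hδ, ← Real.rpow_mul hx0.le, neg_mul, one_div_mul_cancel hκ2.ne', Real.rpow_neg_one,
      inv_mul_cancel₀ hx0.ne']
  have hδ2 : δ ≤ 1 / 2 := by
    by_contra! h
    have : ((1 : ℝ) / 2) ^ (κ - 2) ≤ δ ^ (κ - 2) := by gcongr
    nlinarith
  have hP := tangentsClose_of_energy hp hq hδ0 hδ2 hγ h1 hE hδx.le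
  refine (gagliardoLocal_half_le κ (by linarith) (by linarith) hδ0 h1).trans ?_
  rw [ENNReal.ofReal_add (by positivity) (by positivity)]
  gcongr
  · rw [ENNReal.ofReal_mul ENNReal.toReal_nonneg, ENNReal.ofReal_toReal hE,
      ENNReal.ofReal_toReal (localConst_ne_top hp (by linarith))]
    exact hP.gagliardoLocal_le hp (by linarith) hδ2 hγ h1
  · refine le_of_eq ?_
    rw [hδ, ← Real.rpow_mul hx0.le, div_eq_mul_inv, ← Real.rpow_neg hx0.le]
    congr 2
    ring

end Quantitative

/-! ### From the seminorm to the Sobolev–Slobodeckij norm -/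

section WeakDerivative

variable {n : ℕ} {γ : UnitAddCircle → EuclideanSpace ℝ (Fin n)}

theorem IsC1Curve.isWeakDeriv (hγ : IsC1Curve γ) : IsWeakDeriv γ (curveDeriv γ) := by
  refine ⟨hγ.continuous.integrable_of_hasCompactSupport (HasCompactSupport.of_compactSpace _),
    hγ.continuous_curveDeriv.integrable_of_hasCompactSupport (HasCompactSupport.of_compactSpace _),
    fun φ hφ hc => ?_⟩
  have hcoe : Continuous (fun x : ℝ => (x : UnitAddCircle)) := AddCircle.continuous_mk' 1
  have hγ1 : Continuous fun t : ℝ => γ (t : UnitAddCircle) := hγ.continuous.comp hcoe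
  have hγ2 : Continuous fun t : ℝ => curveDeriv γ (t : UnitAddCircle) :=
    hγ.continuous_curveDeriv.comp hcoe
  have hφ' : Continuous (deriv φ) := hφ.continuous_deriv (by simp)
  have hd : ∀ t : ℝ, HasDerivAt (fun t : ℝ => γ (t : UnitAddCircle))
      (curveDeriv γ (t : UnitAddCircle)) t := by
    intro t
    have := hγ.hasDerivAt 0 t
    simpa only [zero_add] using this
  have h := integral_bilinear_hasDerivAt_right_eq_neg_left_of_integrable
    (L := ContinuousLinearMap.lsmul ℝ ℝ) (u := φ) (u' := deriv φ)
    (v := fun t : ℝ => γ (t : UnitAddCircle)) (v' := fun t : ℝ => curveDeriv γ (t : UnitAddCircle))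
    (fun x _ => (hφ.differentiable (by simp) x).hasDerivAt) (fun x _ => hd x)
    ((hφ.continuous.smul hγ2).integrable_of_hasCompactSupport hc.smul_right)
    ((hφ'.smul hγ1).integrable_of_hasCompactSupport hc.deriv.smul_right)
    ((hφ.continuous.smul hγ1).integrable_of_hasCompactSupport hc.smul_right)
  simp only [ContinuousLinearMap.lsmul_apply] at h
  rw [h, neg_neg]

theorem IsC1Curve.sub_const (hγ : IsC1Curve γ) (c : EuclideanSpace ℝ (Fin n)) :
    IsC1Curve fun u => γ u - c :=
  ContDiff.sub hγ contDiff_const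

theorem curveDeriv_sub_const (γ : UnitAddCircle → EuclideanSpace ℝ (Fin n))
    (c : EuclideanSpace ℝ (Fin n)) : curveDeriv (fun u => γ u - c) = curveDeriv γ := by
  funext u
  exact deriv_sub_const c

theorem UnitAddCircle.eLpNorm_le_one {f : UnitAddCircle → EuclideanSpace ℝ (Fin n)}
    (hf : ∀ u, ‖f u‖ ≤ 1) (r : ℝ≥0∞) : eLpNorm f r volume ≤ 1 := by
  have := eLpNorm_le_of_ae_bound (p := r) (μ := (volume : Measure UnitAddCircle))
    (Filter.Eventually.of_forall hf)
  simpa [UnitAddCircle.measure_univ] using this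

theorem IsC1Curve.norm_sub_le_one (hγ : IsC1Curve γ) (h1 : ∀ u, ‖curveDeriv γ u‖ = 1)
    (u u₀ : UnitAddCircle) : ‖γ u - γ u₀‖ ≤ 1 := by
  obtain ⟨w, hw, e, -⟩ := UnitAddCircle.exists_coe_eq (u - u₀)
  have h := norm_sub_eq_abs_mul_norm_secant γ u₀ w
  rw [e, add_sub_cancel] at h
  rw [h]
  have := hγ.norm_secant_le h1 u₀ w
  nlinarith [norm_nonneg (secant γ u₀ w), abs_nonneg w]

theorem gagliardo_eq_gagliardoLocal (s ρ : ℝ) (g : UnitAddCircle → EuclideanSpace ℝ (Fin n)) :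
    gagliardo s ρ g = gagliardoLocal (1 + ρ * s) ρ (1 / 2) g ^ (1 / ρ) := rfl

theorem IsC1Curve.slobodeckijNorm_sub_le (hγ : IsC1Curve γ) (h1 : ∀ u, ‖curveDeriv γ u‖ = 1)
    (σ q : ℝ) (u₀ : UnitAddCircle) :
    slobodeckijNorm σ q (fun u => γ u - γ u₀) ≤ 2 +
      gagliardoLocal (1 + q * (σ - 1)) q (1 / 2) (curveDeriv γ) ^ (1 / q) := by
  have hw := (hγ.sub_const (γ u₀)).isWeakDeriv
  rw [curveDeriv_sub_const] at hw
  refine (iInf₂_le _ hw).trans ?_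
  rw [gagliardo_eq_gagliardoLocal]
  refine add_le_add ((add_le_add
    (UnitAddCircle.eLpNorm_le_one (fun u => hγ.norm_sub_le_one h1 u u₀) _)
    (UnitAddCircle.eLpNorm_le_one (fun u => (h1 u).le) _)).trans ?_) le_rfl
  norm_num

theorem IsC1Curve.memSlobodeckij (hγ : IsC1Curve γ) {σ q : ℝ} (hq : 0 < q)
    (h : gagliardoLocal (1 + q * (σ - 1)) q (1 / 2) (curveDeriv γ) ≠ ⊤) :
    MemSlobodeckij σ q γ := by
  have hL : ∀ f : UnitAddCircle → EuclideanSpace ℝ (Fin n), Continuous f →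
      MemLp f (ENNReal.ofReal q) := fun f hf =>
    hf.memLp_of_hasCompactSupport (HasCompactSupport.of_compactSpace _)
  refine ⟨⟨hL _ hγ.continuous, _, hγ.isWeakDeriv, hL _ hγ.continuous_curveDeriv⟩, ?_⟩
  refine (iInf₂_le _ hγ.isWeakDeriv).trans_lt ?_
  rw [gagliardo_eq_gagliardoLocal]
  exact ENNReal.add_lt_top.2 ⟨ENNReal.add_lt_top.2 ⟨(hL _ hγ.continuous).eLpNorm_lt_top,
    (hL _ hγ.continuous_curveDeriv).eLpNorm_lt_top⟩,
    ENNReal.rpow_lt_top_of_nonneg (by positivity) h⟩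

theorem exists_slobodeckijNorm_le {p q : ℝ} (hq : 1 < q) (hp : 2 / 3 * q + 1 < p) :
    ∃ C β : ℝ, 0 < C ∧ 0 < β ∧
      ∀ (n : ℕ) (γ : UnitAddCircle → EuclideanSpace ℝ (Fin n)),
        IsC1Curve γ → (∀ u, ‖curveDeriv γ u‖ = 1) → mengerEnergy p q γ < ⊤ →
          ∀ u₀ : UnitAddCircle,
            slobodeckijNorm ((3 * p - 2) / q - 1) q (fun u => γ u - γ u₀) ≤
              ENNReal.ofReal C * (mengerEnergy p q γ + mengerEnergy p q γ ^ β) := by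
  set κ := 3 * p - 2 * q - 1 with hκ
  have hq0 : 0 < q := by linarith
  have hκ2 : 0 < κ - 2 := by linarith
  set K := scaleConst p q
  have hK : 0 < K := scaleConst_pos hq0 hp
  set L := (localConst p q).toReal
  have hL : 0 ≤ L := ENNReal.toReal_nonneg
  set β := κ / (κ - 2) with hβ
  have hβ0 : 0 < β := div_pos (by linarith) hκ2
  refine ⟨3 * K + L + 2 ^ q * K ^ β, β, by positivity, hβ0, fun n γ hγ h1 hE u₀ => ?_⟩
  refine (hγ.slobodeckijNorm_sub_le h1 _ _ u₀).trans ?_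
  have hexp : 1 + q * ((3 * p - 2) / q - 1 - 1) = κ := by
    rw [hκ]
    field_simp
    ring
  rw [hexp]
  have hG := gagliardoLocal_half_le_of_energy hp hq hγ h1 hE.ne
  have hlow := one_lt_energy hp hq hγ h1 hE.ne
  rw [← hκ] at hG hlow
  set e := (mengerEnergy p q γ).toReal with he
  have he0 : 0 ≤ e := ENNReal.toReal_nonneg
  have hEe : mengerEnergy p q γ = ENNReal.ofReal e := (ENNReal.ofReal_toReal hE.ne).symm
  -- The two `L^q` norms and the inequality `x^(1/q) ≤ 1 + x` contribute the constant `3`, which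
  -- this turns into `3Ke`.
  have hKe : 1 ≤ K * e := by
    have h2 : ((1 : ℝ) / 2) ^ (κ - 2) ≤ 1 :=
      Real.rpow_le_one (by norm_num) (by norm_num) hκ2.le
    nlinarith [mul_nonneg hK.le he0]
  have hpow : ∀ x : ℝ≥0∞, x ^ (1 / q) ≤ 1 + x := by
    intro x
    rcases le_total x 1 with h | h
    · exact (ENNReal.rpow_le_one h (by positivity)).trans le_self_add
    · refine le_trans ?_ le_add_self
      have := ENNReal.rpow_le_rpow_of_exponent_le h ((div_le_one hq0).2 hq.le)
      rwa [ENNReal.rpow_one] at this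
  calc _ ≤ 2 + (1 + ENNReal.ofReal (L * e + 2 ^ q * (K * e) ^ β)) := by
        gcongr
        exact (hpow _).trans (by gcongr)
    _ = ENNReal.ofReal (3 + (L * e + 2 ^ q * (K * e) ^ β)) := by
        have hpos : 0 ≤ L * e + 2 ^ q * (K * e) ^ β :=
          add_nonneg (mul_nonneg hL he0) (by positivity)
        rw [← add_assoc, ENNReal.ofReal_add (by norm_num) hpos, ENNReal.ofReal_ofNat]
        norm_num
    _ ≤ ENNReal.ofReal ((3 * K + L + 2 ^ q * K ^ β) * (e + e ^ β)) := by
        refine ENNReal.ofReal_le_ofReal ?_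
        rw [Real.mul_rpow hK.le he0]
        have h2 : 0 ≤ e ^ β := by positivity
        have h3 : 0 ≤ 2 ^ q * K ^ β := by positivity
        nlinarith [mul_nonneg h3 he0, mul_nonneg hL h2, mul_nonneg hK.le h2]
    _ = _ := by
        rw [hEe, ENNReal.ofReal_rpow_of_nonneg he0 hβ0.le, ENNReal.ofReal_mul (by positivity),
          ENNReal.ofReal_add he0 (by positivity)]

theorem memSlobodeckij_of_energy {p q : ℝ} (hq : 1 < q) (hp : 2 / 3 * q + 1 < p)
    (hγ : IsC1Curve γ) (h1 : ∀ u, ‖curveDeriv γ u‖ = 1) (hE : mengerEnergy p q γ < ⊤) :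
    MemSlobodeckij ((3 * p - 2) / q - 1) q γ := by
  have hq0 : 0 < q := by linarith
  refine hγ.memSlobodeckij hq0 ?_
  have hexp : 1 + q * ((3 * p - 2) / q - 1 - 1) = 3 * p - 2 * q - 1 := by
    field_simp
    ring
  rw [hexp]
  exact ((gagliardoLocal_half_le_of_energy hp hq hγ h1 hE.ne).trans_lt ENNReal.ofReal_lt_top).ne

end WeakDerivative

/-! ### Uniqueness of weak derivatives -/

section WeakDerivativeUnique

variable {n : ℕ} {γ : UnitAddCircle → EuclideanSpace ℝ (Fin n)}

theorem UnitAddCircle.locallyIntegrable_coe {f : UnitAddCircle → EuclideanSpace ℝ (Fin n)}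
    (hf : Integrable f) : LocallyIntegrable (fun t : ℝ => f (t : UnitAddCircle)) := by
  intro x
  refine ⟨Ioc (x - 1 / 2) (x - 1 / 2 + 1), Ioc_mem_nhds (by linarith) (by linarith), ?_⟩
  exact (UnitAddCircle.measurePreserving_mk (x - 1 / 2)).integrable_comp_of_integrable hf

theorem IsWeakDeriv.ae_eq {f g₁ g₂ : UnitAddCircle → EuclideanSpace ℝ (Fin n)}
    (h₁ : IsWeakDeriv f g₁) (h₂ : IsWeakDeriv f g₂) : g₁ =ᵐ[volume] g₂ := by
  obtain ⟨-, hi₁, h₁⟩ := h₁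
  obtain ⟨-, hi₂, h₂⟩ := h₂
  have hl₁ := UnitAddCircle.locallyIntegrable_coe hi₁
  have hl₂ := UnitAddCircle.locallyIntegrable_coe hi₂
  have h : ∀ᵐ t : ℝ, g₁ (t : UnitAddCircle) - g₂ (t : UnitAddCircle) = 0 := by
    refine ae_eq_zero_of_integral_contDiff_smul_eq_zero (hl₁.sub hl₂) fun φ hφ hc => ?_
    have e := (h₁ φ hφ hc).symm.trans (h₂ φ hφ hc)
    simp only [smul_sub]
    rw [integral_sub (hl₁.integrable_smul_left_of_hasCompactSupport hφ.continuous hc)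
      (hl₂.integrable_smul_left_of_hasCompactSupport hφ.continuous hc), neg_inj.1 e, sub_self]
  have hn : NullMeasurableSet {x | g₁ x = g₂ x}ᶜ (volume : Measure UnitAddCircle) :=
    (hi₁.aestronglyMeasurable.nullMeasurableSet_eq_fun hi₂.aestronglyMeasurable).compl
  rw [Filter.EventuallyEq, ae_iff]
  refine ((UnitAddCircle.measurePreserving_mk 0).measure_preimage hn).symm.trans ?_
  refine measure_mono_null ?_ (ae_iff.1 (ae_restrict_of_ae (s := Ioc 0 (0 + 1)) h))
  intro t ht ht'
  exact ht (sub_eq_zero.1 ht')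

theorem gagliardoLocal_half_congr (κ q : ℝ)
    {g₁ g₂ : UnitAddCircle → EuclideanSpace ℝ (Fin n)} (h : g₁ =ᵐ[volume] g₂) :
    gagliardoLocal κ q (1 / 2) g₁ = gagliardoLocal κ q (1 / 2) g₂ := by
  refine lintegral_congr_ae ?_
  filter_upwards [h] with u hu
  have h1 : ∀ᵐ x : UnitAddCircle, g₁ (u + x) = g₂ (u + x) :=
    (measurePreserving_add_left volume u).quasiMeasurePreserving.ae
      (p := fun x => g₁ x = g₂ x) h
  have h2 : ∀ᵐ w : ℝ ∂volume.restrict (Ioc (-(1 / 2)) (-(1 / 2) + 1)),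
      g₁ (u + (w : UnitAddCircle)) = g₂ (u + (w : UnitAddCircle)) :=
    (UnitAddCircle.measurePreserving_mk (-(1 / 2))).quasiMeasurePreserving.ae
      (p := fun x => g₁ (u + x) = g₂ (u + x)) h1
  have h3 : ∀ᵐ w : ℝ ∂volume.restrict (Ioo (-(1 / 2)) (1 / 2)),
      g₁ (u + (w : UnitAddCircle)) = g₂ (u + (w : UnitAddCircle)) := by
    have hs : Ioo (-(1 / 2) : ℝ) (1 / 2) ⊆ Ioc (-(1 / 2)) (-(1 / 2) + 1) := fun w hw =>
      ⟨hw.1, by linarith [hw.2]⟩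
    exact ae_restrict_of_ae_restrict_of_subset hs h2
  refine lintegral_congr_ae ?_
  filter_upwards [h3] with w hw
  rw [hw, hu]

/-- The infimum in the norm may be attained by any weak derivative, but each agrees almost
everywhere with the classical one and has the same Gagliardo integral. -/
theorem MemSlobodeckij.gagliardoLocal_lt_top {σ q : ℝ} (hq : 0 < q) (hγ : IsC1Curve γ)
    (h : MemSlobodeckij σ q γ) :
    gagliardoLocal (1 + q * (σ - 1)) q (1 / 2) (curveDeriv γ) < ⊤ := by
  obtain ⟨-, h⟩ := h
  simp only [slobodeckijNorm, iInf_lt_iff] at h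
  obtain ⟨g, hg, h⟩ := h
  rw [gagliardoLocal_half_congr _ _ (hγ.isWeakDeriv.ae_eq hg)]
  have h2 := (le_add_self.trans_lt h : gagliardo (σ - 1) q g < ⊤)
  rw [gagliardo_eq_gagliardoLocal] at h2
  exact (ENNReal.rpow_lt_top_iff_of_pos (by positivity)).1 h2

end WeakDerivativeUnique

/-! ### The bi-Lipschitz estimate -/

section BiLipschitz

variable {n : ℕ} {γ : UnitAddCircle → EuclideanSpace ℝ (Fin n)}

/-- Nearby points are handled by close tangents, distant ones by compactness and injectivity.
Injectivity enters the theorem only here. -/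
theorem IsC1Curve.exists_biLipschitz (hγ : IsC1Curve γ) (hinj : Function.Injective γ)
    (h1 : ∀ u, ‖curveDeriv γ u‖ = 1) :
    ∃ c : ℝ, 0 < c ∧ ∀ x y, c * ‖x - y‖ ≤ ‖γ x - γ y‖ := by
  obtain ⟨η, hη, hclose⟩ := hγ.exists_tangentsClose_half
  have hP : TangentsClose γ η := fun u w hw => (hclose u w hw).trans (by norm_num)
  have hnear : ∀ x y, ‖x - y‖ < η → 1 / 2 * ‖x - y‖ ≤ ‖γ x - γ y‖ := by
    intro x y hxy
    obtain ⟨w, -, e, en⟩ := UnitAddCircle.exists_coe_eq (x - y)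
    have h := norm_sub_eq_abs_mul_norm_secant γ y w
    rw [e, add_sub_cancel] at h
    rw [h, en]
    rcases eq_or_ne w 0 with rfl | hw
    · simp
    have := hP.half_le_norm_secant hγ h1 y (en ▸ hxy) hw
    rw [mul_comm]
    gcongr
  set K : Set (UnitAddCircle × UnitAddCircle) := {z | η ≤ ‖z.1 - z.2‖}
  have hK : IsCompact K := (isClosed_le continuous_const (by fun_prop)).isCompact
  have hcont : Continuous fun z : UnitAddCircle × UnitAddCircle => ‖γ z.1 - γ z.2‖ := by
    have := hγ.continuous
    fun_prop
  rcases K.eq_empty_or_nonempty with hE | hne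
  · refine ⟨1 / 2, by norm_num, fun x y => hnear x y ?_⟩
    by_contra! h
    exact (hE ▸ (h : (x, y) ∈ K) : (x, y) ∈ (∅ : Set _))
  obtain ⟨z, hz, hmin⟩ := hK.exists_isMinOn hne hcont.continuousOn
  have hm : 0 < ‖γ z.1 - γ z.2‖ := by
    rw [norm_pos_iff, sub_ne_zero]
    intro h
    have hz' : η ≤ ‖z.1 - z.2‖ := hz
    rw [hinj h, sub_self, norm_zero] at hz'
    linarith
  refine ⟨min (1 / 2) ‖γ z.1 - γ z.2‖, lt_min (by norm_num) hm, fun x y => ?_⟩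
  rcases lt_or_ge ‖x - y‖ η with h | h
  · exact (mul_le_mul_of_nonneg_right (min_le_left _ _) (norm_nonneg _)).trans (hnear x y h)
  · have hxy : (x, y) ∈ K := h
    have h2 : ‖γ z.1 - γ z.2‖ ≤ ‖γ x - γ y‖ := isMinOn_iff.1 hmin (x, y) hxy
    obtain ⟨w, hw, -, en⟩ := UnitAddCircle.exists_coe_eq (x - y)
    refine le_trans ?_ h2
    rw [en]
    have := min_le_right (1 / 2) ‖γ z.1 - γ z.2‖
    have h3 : 0 < min (1 / 2) ‖γ z.1 - γ z.2‖ := lt_min (by norm_num) hm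
    nlinarith [abs_nonneg w]

end BiLipschitz

/-! ### The homogeneous weight and its integrability -/

section Kernel

/-- The integral of the reduced weight over the ratio of the two parameters. -/
def weightConst (p q : ℝ) : ℝ≥0∞ := ∫⁻ t : ℝ, ENNReal.ofReal (|t| ^ (q - p) / max 1 |t| ^ p)

/-- The integrand behaves like `|t|^(q-p)` at `0` and `|t|^(q-2p)` at infinity; the bounds on `p`
give `q - p > -1` and `q - 2p < -1`. -/
theorem weightConst_ne_top {p q : ℝ} (hq : 1 < q) (hp₁ : 2 / 3 * q + 1 < p) (hp₂ : p < q + 2 / 3) :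
    weightConst p q ≠ ⊤ := by
  set F : ℝ → ℝ≥0∞ := fun t => ENNReal.ofReal (|t| ^ (q - p) / max 1 |t| ^ p)
  have hpos : ∫⁻ t in Ioi 0, F t < ⊤ := by
    refine (lintegral_mono_set (t := Ioc 0 1 ∪ Ioi 1) fun t (ht : 0 < t) => ?_).trans_lt
      ((lintegral_union_le _ _ _).trans_lt (ENNReal.add_lt_top.2 ⟨?_, ?_⟩))
    · rcases le_or_gt t 1 with h | h
      · exact Or.inl ⟨ht, h⟩
      · exact Or.inr h
    · have hi : IntegrableOn (fun t : ℝ => t ^ (q - p)) (Ioc 0 1) :=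
        ((intervalIntegral.integrableOn_Ioo_rpow_iff (t := 2) two_pos).2 (by linarith)).mono_set
          fun t ht => ⟨ht.1, by linarith [ht.2]⟩
      refine (setLIntegral_mono' measurableSet_Ioc fun t ht => ?_).trans_lt hi.setLIntegral_lt_top
      simp only [F]
      rw [abs_of_pos ht.1, max_eq_left ht.2, Real.one_rpow, div_one]
    · have hi := integrableOn_Ioi_rpow_of_lt (a := q - p - p) (by linarith) zero_lt_one
      refine (setLIntegral_mono' measurableSet_Ioi fun t (ht : 1 < t) => ?_).trans_lt
        hi.setLIntegral_lt_top
      have ht0 : 0 < t := by linarith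
      simp only [F]
      rw [abs_of_pos ht0, max_eq_right ht.le, Real.rpow_sub ht0 (q - p)]
  have hneg : ∫⁻ t in Iio 0, F t = ∫⁻ t in Ioi 0, F t := by
    have := (Measure.measurePreserving_neg (volume : Measure ℝ)).setLIntegral_comp_preimage_emb
      (MeasurableEquiv.neg ℝ).measurableEmbedding F (Ioi 0)
    rw [← this]
    simp [F]
  rw [weightConst, ← lintegral_add_compl _ (measurableSet_Ioi (a := (0 : ℝ))), compl_Ioi,
    ← Measure.restrict_congr_set Iio_ae_eq_Iic]
  exact (ENNReal.add_lt_top.2 ⟨hpos, hneg ▸ hpos⟩).ne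

/-- The weight bounding the integral Menger curvature of a bi-Lipschitz curve. -/
def weight (p q v w : ℝ) : ℝ := (|v| * |w|) ^ (q - p) / max |v| |w| ^ p

theorem weight_comm (p q v w : ℝ) : weight p q v w = weight p q w v := by
  rw [weight, weight, mul_comm, max_comm]

theorem weight_nonneg (p q v w : ℝ) : 0 ≤ weight p q v w := by
  unfold weight
  positivity

theorem measurable_weight (p q : ℝ) : Measurable fun x : ℝ × ℝ => weight p q x.1 x.2 := by
  unfold weight
  have h1 : Continuous fun x : ℝ × ℝ => |x.1| * |x.2| := by fun_prop
  have h2 : Continuous fun x : ℝ × ℝ => max |x.1| |x.2| := by fun_prop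
  exact (h1.measurable.pow_const _).div (h2.measurable.pow_const _)

/-- The weight is homogeneous of degree `2q - 3p`, and integrating in `w` adds one: the result
scales like `|v|^(-κ)`. -/
theorem lintegral_weight (p q : ℝ) {v : ℝ} (hv : v ≠ 0) :
    ∫⁻ w, ENNReal.ofReal (weight p q v w) =
      ENNReal.ofReal (|v| ^ (3 * p - 2 * q - 1))⁻¹ * weightConst p q := by
  have hv0 : 0 < |v| := abs_pos.2 hv
  have h := lintegral_comp_mul_left_real hv0.ne' fun w => ENNReal.ofReal (weight p q v w)
  have e : ∀ t, weight p q v (|v| * t) = |v| ^ (2 * (q - p) - p) *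
      (|t| ^ (q - p) / max 1 |t| ^ p) := by
    intro t
    have hmax : max |v| (|v| * |t|) = |v| * max 1 |t| := by
      rw [mul_max_of_nonneg _ _ hv0.le, mul_one]
    have hexp : |v| ^ (2 * (q - p) - p) = |v| ^ (q - p) * |v| ^ (q - p) / |v| ^ p := by
      rw [two_mul, Real.rpow_sub hv0 (q - p + (q - p)) p, Real.rpow_add hv0]
    rw [weight, abs_mul, abs_abs, hmax, Real.mul_rpow hv0.le (by positivity),
      Real.mul_rpow hv0.le (by positivity), Real.mul_rpow hv0.le (by positivity), hexp]
    field_simp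
  simp_rw [e, ENNReal.ofReal_mul (Real.rpow_nonneg hv0.le _)] at h
  rw [lintegral_const_mul' _ _ (by simp)] at h
  have h2 : ∫⁻ w, ENNReal.ofReal (weight p q v w) = ENNReal.ofReal |v| *
      (ENNReal.ofReal |(|v|)⁻¹| * ∫⁻ w, ENNReal.ofReal (weight p q v w)) := by
    rw [← mul_assoc, ← ENNReal.ofReal_mul hv0.le, abs_of_pos (inv_pos.2 hv0),
      mul_inv_cancel₀ hv0.ne', ENNReal.ofReal_one, one_mul]
  rw [h2, ← h, ← mul_assoc, ← ENNReal.ofReal_mul hv0.le, weightConst]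
  congr 2
  rw [← Real.rpow_neg hv0.le]
  nth_rw 1 [← Real.rpow_one |v|]
  rw [← Real.rpow_add hv0]
  congr 1
  ring

end Kernel

/-! ### Sobolev regularity implies finite energy -/

section Converse

variable {n : ℕ} {γ : UnitAddCircle → EuclideanSpace ℝ (Fin n)}

theorem mengerKernel_comm_left (p q : ℝ) (γ : UnitAddCircle → EuclideanSpace ℝ (Fin n))
    (x y z : UnitAddCircle) : mengerKernel p q γ x y z = mengerKernel p q γ y x z := by
  have hw : wedgeNorm (γ x - γ y) (γ z - γ y) = wedgeNorm (γ y - γ x) (γ z - γ x) := by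
    rw [← neg_sub (γ y), wedgeNorm_neg_left, wedgeNorm_comm, ← sub_sub_sub_cancel_right _ _ (γ x),
      wedgeNorm_sub_left, wedgeNorm_comm]
  rw [mengerKernel, mengerKernel, hw, norm_sub_rev (γ x) (γ y), norm_sub_rev (γ x) (γ z),
    norm_sub_rev (γ z) (γ y)]
  congr 3
  ring

theorem mengerKernel_comm_right (p q : ℝ) (γ : UnitAddCircle → EuclideanSpace ℝ (Fin n))
    (x y z : UnitAddCircle) : mengerKernel p q γ x y z = mengerKernel p q γ x z y := by
  rw [mengerKernel, mengerKernel, wedgeNorm_comm, norm_sub_rev (γ y) (γ z)]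
  congr 3
  ring

/-- The triples whose second and third point have the largest mutual distance. -/
def apexTriples : Set (UnitAddCircle × UnitAddCircle × UnitAddCircle) :=
  {a | ‖a.2.1 - a.1‖ ≤ ‖a.2.1 - a.2.2‖ ∧ ‖a.2.2 - a.1‖ ≤ ‖a.2.1 - a.2.2‖}

theorem measurableSet_apexTriples : MeasurableSet apexTriples := by
  have h1 : IsClosed {a : UnitAddCircle × UnitAddCircle × UnitAddCircle |
      ‖a.2.1 - a.1‖ ≤ ‖a.2.1 - a.2.2‖} := isClosed_le (by fun_prop) (by fun_prop)
  have h2 : IsClosed {a : UnitAddCircle × UnitAddCircle × UnitAddCircle |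
      ‖a.2.2 - a.1‖ ≤ ‖a.2.1 - a.2.2‖} := isClosed_le (by fun_prop) (by fun_prop)
  exact (h1.inter h2).measurableSet

/-- The integrand of the integral Menger curvature, restricted to `apexTriples`. -/
def apexKernel (p q : ℝ) (γ : UnitAddCircle → EuclideanSpace ℝ (Fin n)) :
    UnitAddCircle × UnitAddCircle × UnitAddCircle → ℝ≥0∞ :=
  apexTriples.indicator fun a => mengerKernel p q γ a.1 a.2.1 a.2.2

theorem measurable_apexKernel (p q : ℝ) (hγ : Continuous γ) : Measurable (apexKernel p q γ) :=
  (measurable_mengerKernel p q hγ measurable_fst measurable_snd.fst measurable_snd.snd).indicator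
    measurableSet_apexTriples

/-- The kernel is symmetric, and some side of the triangle of parameters is longest; the opposite
point can serve as base point. -/
theorem mengerKernel_le_apexKernel (p q : ℝ) (γ : UnitAddCircle → EuclideanSpace ℝ (Fin n))
    (x y z : UnitAddCircle) : mengerKernel p q γ x y z ≤
      apexKernel p q γ (x, y, z) + apexKernel p q γ (y, x, z) + apexKernel p q γ (z, x, y) := by
  by_cases h1 : (x, y, z) ∈ apexTriples
  · rw [add_assoc, apexKernel, indicator_of_mem h1]
    exact le_self_add
  by_cases h2 : (y, x, z) ∈ apexTriples
  · rw [mengerKernel_comm_left]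
    have : mengerKernel p q γ y x z = apexKernel p q γ (y, x, z) := by
      rw [apexKernel, indicator_of_mem h2]
    rw [this, add_right_comm]
    exact le_add_self
  have h3 : (z, x, y) ∈ apexTriples := by
    simp only [apexTriples, mem_ofPred_eq, not_and_or, not_le] at h1 h2 ⊢
    rw [norm_sub_rev x y] at *
    rw [norm_sub_rev z x] at *
    rw [norm_sub_rev z y] at *
    rcases h1 with h1 | h1 <;> rcases h2 with h2 | h2 <;> constructor <;> linarith
  rw [mengerKernel_comm_right, mengerKernel_comm_left]
  have : mengerKernel p q γ z x y = apexKernel p q γ (z, x, y) := by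
    rw [apexKernel, indicator_of_mem h3]
  rw [this]
  exact le_add_self

theorem lintegral_triple_comm_left {H : UnitAddCircle × UnitAddCircle × UnitAddCircle → ℝ≥0∞}
    (hH : Measurable H) :
    ∫⁻ x, ∫⁻ y, ∫⁻ z, H (y, x, z) = ∫⁻ x, ∫⁻ y, ∫⁻ z, H (x, y, z) := by
  refine lintegral_lintegral_swap (Measurable.aemeasurable ?_)
  have : Measurable (Function.uncurry fun (a : UnitAddCircle × UnitAddCircle) (z : UnitAddCircle) =>
      H (a.2, a.1, z)) :=
    hH.comp (measurable_fst.snd.prodMk (measurable_fst.fst.prodMk measurable_snd))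
  exact this.lintegral_prod_right

theorem lintegral_triple_comm_right {H : UnitAddCircle × UnitAddCircle × UnitAddCircle → ℝ≥0∞}
    (hH : Measurable H) :
    ∫⁻ x, ∫⁻ y, ∫⁻ z, H (x, z, y) = ∫⁻ x, ∫⁻ y, ∫⁻ z, H (x, y, z) := by
  refine lintegral_congr fun x => lintegral_lintegral_swap (Measurable.aemeasurable ?_)
  exact hH.comp (measurable_const.prodMk (measurable_snd.prodMk measurable_fst))

theorem mengerEnergy_le_apexKernel (p q : ℝ) (hγ : Continuous γ)
    (h1 : ∀ u, ‖curveDeriv γ u‖ = 1) :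
    mengerEnergy p q γ ≤ 3 * ∫⁻ x, ∫⁻ y, ∫⁻ z, apexKernel p q γ (x, y, z) := by
  set H := apexKernel p q γ
  have hH : Measurable H := measurable_apexKernel p q hγ
  have e2 : ∫⁻ x, ∫⁻ y, ∫⁻ z, H (z, x, y) = ∫⁻ x, ∫⁻ y, ∫⁻ z, H (x, y, z) := by
    rw [← lintegral_triple_comm_left hH]
    refine lintegral_triple_comm_right (H := fun a => H (a.2.1, a.1, a.2.2)) ?_
    exact hH.comp (measurable_snd.fst.prodMk (measurable_fst.prodMk measurable_snd.snd))
  have hm : ∀ x y z : UnitAddCircle × UnitAddCircle × UnitAddCircle → UnitAddCircle,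
      Measurable x → Measurable y → Measurable z → Measurable fun a => H (x a, y a, z a) :=
    fun x y z hx hy hz => hH.comp (hx.prodMk (hy.prodMk hz))
  have hsum : ∀ A B : UnitAddCircle × UnitAddCircle × UnitAddCircle → ℝ≥0∞, Measurable A →
      ∫⁻ x, ∫⁻ y, ∫⁻ z, (A (x, y, z) + B (x, y, z)) =
      (∫⁻ x, ∫⁻ y, ∫⁻ z, A (x, y, z)) + ∫⁻ x, ∫⁻ y, ∫⁻ z, B (x, y, z) := by
    intro A B hA
    have hA1 : ∀ x y, Measurable fun z => A (x, y, z) := fun x y =>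
      hA.comp (measurable_const.prodMk (measurable_const.prodMk measurable_id))
    have hA2 : Measurable (Function.uncurry fun (a : UnitAddCircle × UnitAddCircle)
        (z : UnitAddCircle) => A (a.1, a.2, z)) :=
      hA.comp (measurable_fst.fst.prodMk (measurable_fst.snd.prodMk measurable_snd))
    have hA3 : Measurable (Function.uncurry fun x y => ∫⁻ z, A (x, y, z)) :=
      hA2.lintegral_prod_right
    rw [← lintegral_add_left hA3.lintegral_prod_right]
    refine lintegral_congr fun x => ?_
    have hAx : Measurable fun y => ∫⁻ z, A (x, y, z) := hA3.comp measurable_prodMk_left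
    rw [← lintegral_add_left hAx]
    refine lintegral_congr fun y => ?_
    rw [← lintegral_add_left (hA1 x y)]
  rw [mengerEnergy_eq p q h1]
  calc _ ≤ ∫⁻ x, ∫⁻ y, ∫⁻ z, (H (x, y, z) + H (y, x, z) + H (z, x, y)) :=
        lintegral_mono fun x => lintegral_mono fun y => lintegral_mono fun z =>
          mengerKernel_le_apexKernel p q γ x y z
    _ = _ := by
        rw [hsum (fun a => H (a.1, a.2.1, a.2.2) + H (a.2.1, a.1, a.2.2))
          (fun a => H (a.2.2, a.1, a.2.1)) ((hm _ _ _ measurable_fst measurable_snd.fst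
            measurable_snd.snd).add (hm _ _ _ measurable_snd.fst measurable_fst
            measurable_snd.snd)),
          hsum (fun a => H (a.1, a.2.1, a.2.2)) (fun a => H (a.2.1, a.1, a.2.2))
            (hm _ _ _ measurable_fst measurable_snd.fst measurable_snd.snd)]
        simp only []
        rw [e2, lintegral_triple_comm_left hH]
        ring

/-- The side opposite `x` is at least `c · max |v| |w|`, so the denominator never degenerates when
`v` is near `w`. -/
theorem apexKernel_le {p q c : ℝ} (hp : 0 < p) (hq : 0 < q) (hc : 0 < c) (hγ : IsC1Curve γ)
    (h1 : ∀ u, ‖curveDeriv γ u‖ = 1) (hbi : ∀ x y, c * ‖x - y‖ ≤ ‖γ x - γ y‖)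
    (x : UnitAddCircle) {v w : ℝ} (hv : |v| ≤ 1 / 2) (hw : |w| ≤ 1 / 2) :
    apexKernel p q γ (x, x + (v : UnitAddCircle), x + (w : UnitAddCircle)) ≤
      ENNReal.ofReal (2 ^ q / (c ^ 3) ^ p) * (ENNReal.ofReal (weight p q v w) *
        (ENNReal.ofReal (‖secant γ x v - curveDeriv γ x‖ ^ q) +
          ENNReal.ofReal (‖secant γ x w - curveDeriv γ x‖ ^ q))) := by
  by_cases hT : (x, x + (v : UnitAddCircle), x + (w : UnitAddCircle)) ∈ apexTriples
  swap
  · rw [apexKernel, indicator_of_notMem hT]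
    exact zero_le
  rw [apexKernel, indicator_of_mem hT]
  simp only [mengerKernel]
  have hnv : ‖(v : UnitAddCircle)‖ = |v| :=
    (AddCircle.norm_coe_eq_abs_iff 1 one_ne_zero).2 (by simpa using hv)
  have hnw : ‖(w : UnitAddCircle)‖ = |w| :=
    (AddCircle.norm_coe_eq_abs_iff 1 one_ne_zero).2 (by simpa using hw)
  rcases eq_or_ne v 0 with rfl | hv0
  · simp [wedgeNorm, Real.zero_rpow hq.ne']
  rcases eq_or_ne w 0 with rfl | hw0
  · simp [wedgeNorm, Real.zero_rpow hq.ne']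
  have hv0' : 0 < |v| := abs_pos.2 hv0
  have hw0' : 0 < |w| := abs_pos.2 hw0
  simp only [apexTriples, mem_ofPred_eq, add_sub_cancel_left, hnv, hnw] at hT
  set m := max |v| |w| with hm
  have hm0 : 0 < m := lt_max_of_lt_left hv0'
  have hX : c ^ 3 * (|v| * |w| * m) ≤ ‖γ (x + (v : UnitAddCircle)) - γ (x + (w : UnitAddCircle))‖ *
      ‖γ (x + (v : UnitAddCircle)) - γ x‖ * ‖γ (x + (w : UnitAddCircle)) - γ x‖ := by
    have b1 := hbi (x + (v : UnitAddCircle)) (x + (w : UnitAddCircle))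
    have b2 := hbi (x + (v : UnitAddCircle)) x
    have b3 := hbi (x + (w : UnitAddCircle)) x
    rw [add_sub_cancel_left] at b2 b3
    rw [hnv] at b2
    rw [hnw] at b3
    have b1' : c * m ≤ ‖γ (x + (v : UnitAddCircle)) - γ (x + (w : UnitAddCircle))‖ :=
      le_trans (by gcongr; exact max_le hT.1 hT.2) b1
    calc c ^ 3 * (|v| * |w| * m) = (c * m) * (c * |v|) * (c * |w|) := by ring
      _ ≤ _ := by gcongr
  set a := ‖secant γ x v - curveDeriv γ x‖ with ha
  set b := ‖secant γ x w - curveDeriv γ x‖ with hb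
  have ha0 : 0 ≤ a := norm_nonneg _
  have hb0 : 0 ≤ b := norm_nonneg _
  have hW : wedgeNorm (γ (x + (v : UnitAddCircle)) - γ x) (γ (x + (w : UnitAddCircle)) - γ x) ≤
      |v| * |w| * (a + b) := by
    rw [← smul_secant γ x hv0, ← smul_secant γ x hw0, wedgeNorm_smul_smul]
    refine mul_le_mul_of_nonneg_left ?_ (by positivity)
    -- A shear preserves area and replaces one secant by the difference of the two, which passes
    -- through `γ'(x)`.
    rw [← wedgeNorm_sub_left]
    refine (wedgeNorm_le _ _).trans ?_
    have h2 := hγ.norm_secant_le h1 x w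
    have h3 : ‖secant γ x v - secant γ x w‖ ≤ a + b := by
      rw [ha, hb, norm_sub_rev (secant γ x w)]
      exact norm_sub_le_norm_sub_add_norm_sub _ _ _
    have := mul_le_mul h3 h2 (norm_nonneg _) (by positivity)
    rwa [mul_one] at this
  rw [← ENNReal.ofReal_add (by positivity) (by positivity),
    ← ENNReal.ofReal_mul (weight_nonneg _ _ _ _), ← ENNReal.ofReal_mul (by positivity)]
  refine ENNReal.ofReal_le_ofReal ?_
  have hwn := wedgeNorm_nonneg (γ (x + (v : UnitAddCircle)) - γ x)
    (γ (x + (w : UnitAddCircle)) - γ x)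
  calc _ ≤ (|v| * |w| * (a + b)) ^ q / (c ^ 3 * (|v| * |w| * m)) ^ p := by gcongr
    _ = (|v| * |w|) ^ q * (a + b) ^ q / (c ^ 3 * (|v| * |w| * m)) ^ p := by
        rw [Real.mul_rpow (by positivity) (by positivity)]
    _ ≤ (|v| * |w|) ^ q * (2 ^ q * (a ^ q + b ^ q)) / (c ^ 3 * (|v| * |w| * m)) ^ p := by
        gcongr
        exact add_rpow_le_two_rpow_mul hq ha0 hb0
    _ = _ := by
        have e : (c ^ 3 * (|v| * |w| * m)) ^ p = (c ^ 3) ^ p * ((|v| * |w|) ^ p * m ^ p) := by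
          rw [Real.mul_rpow (by positivity) (by positivity),
            Real.mul_rpow (by positivity) hm0.le]
        rw [weight, ← hm, e, Real.rpow_sub (by positivity)]
        field_simp

theorem lintegral_apexKernel_le {p q c : ℝ} (hp : 0 < p) (hq : 0 < q) (hc : 0 < c)
    (hγ : IsC1Curve γ) (h1 : ∀ u, ‖curveDeriv γ u‖ = 1)
    (hbi : ∀ x y, c * ‖x - y‖ ≤ ‖γ x - γ y‖) (x : UnitAddCircle) :
    ∫⁻ y, ∫⁻ z, apexKernel p q γ (x, y, z) ≤
      ENNReal.ofReal (2 ^ q / (c ^ 3) ^ p) * (2 * (weightConst p q *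
        ∫⁻ v in Ioo (-(1 / 2) : ℝ) (1 / 2), ENNReal.ofReal
          (‖secant γ x v - curveDeriv γ x‖ ^ q / |v| ^ (3 * p - 2 * q - 1)))) := by
  obtain ⟨φ, hφ⟩ : ∃ φ : ℝ → ℝ≥0∞, φ = fun v =>
    ENNReal.ofReal (‖secant γ x v - curveDeriv γ x‖ ^ q) := ⟨_, rfl⟩
  have hφm : Measurable φ := by
    have h2 : Measurable fun v => secant γ x v :=
      (measurable_secant hγ.continuous).comp measurable_prodMk_left
    rw [hφ]
    exact ((h2.sub_const _).norm.pow_const q).ennreal_ofReal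
  set I : Set ℝ := Ioc (-(1 / 2)) (-(1 / 2) + 1) with hI
  have hIabs : ∀ v ∈ I, |v| ≤ 1 / 2 := by
    intro v hv
    rw [abs_le]
    constructor <;> linarith [hv.1, hv.2]
  have hcircle : ∀ f : UnitAddCircle → ℝ≥0∞,
      ∫⁻ y, f y = ∫⁻ v : ℝ in I, f (x + (v : UnitAddCircle)) := by
    intro f
    rw [← lintegral_add_left_eq_self f x,
      ← UnitAddCircle.lintegral_preimage (-(1 / 2)) (fun y => f (x + y))]
  obtain ⟨k, hk⟩ : ∃ k : ℝ → ℝ → ℝ≥0∞, k = fun v w => ENNReal.ofReal (weight p q v w) := ⟨_, rfl⟩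
  have hkm : Measurable (Function.uncurry k) := by
    rw [hk]
    exact (measurable_weight p q).ennreal_ofReal
  have hm1 : Measurable (Function.uncurry fun v w => k v w * φ v) :=
    hkm.mul (hφm.comp measurable_fst)
  have hm2 : Measurable (Function.uncurry fun v w => k v w * φ w) :=
    hkm.mul (hφm.comp measurable_snd)
  -- The weight is symmetric, so both deviation terms contribute equally; this is the factor `2`.
  have hswap : ∫⁻ v in I, ∫⁻ w in I, k v w * φ w = ∫⁻ v in I, ∫⁻ w in I, k v w * φ v := by
    rw [lintegral_lintegral_swap hm2.aemeasurable]
    simp only [hk, weight_comm]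
  have hbound : ∫⁻ v in I, ∫⁻ w in I, k v w * φ v ≤ weightConst p q *
      ∫⁻ v in Ioo (-(1 / 2) : ℝ) (1 / 2), ENNReal.ofReal
          (‖secant γ x v - curveDeriv γ x‖ ^ q / |v| ^ (3 * p - 2 * q - 1)) := by
    have hIoo : volume.restrict (Ioo (-(1 / 2) : ℝ) (1 / 2)) = volume.restrict I := by
      rw [hI, show (-(1 / 2) + 1 : ℝ) = 1 / 2 by norm_num]
      exact Measure.restrict_congr_set Ioo_ae_eq_Ioc
    have hκm : Measurable fun v : ℝ => ENNReal.ofReal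
          (‖secant γ x v - curveDeriv γ x‖ ^ q / |v| ^ (3 * p - 2 * q - 1)) := by
      have h2 : Measurable fun v => secant γ x v :=
        (measurable_secant hγ.continuous).comp measurable_prodMk_left
      exact (((h2.sub_const _).norm.pow_const q).div
        (continuous_abs.measurable.pow_const _)).ennreal_ofReal
    rw [hIoo, ← lintegral_const_mul _ hκm]
    refine lintegral_mono_ae ?_
    have h0 : ∀ᵐ v : ℝ ∂volume.restrict I, v ≠ 0 :=
      ae_restrict_of_ae (Measure.ae_ne volume 0)
    filter_upwards [h0] with v hv
    have hkv : Measurable fun w => k v w := hkm.comp measurable_prodMk_left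
    rw [lintegral_mul_const _ hkv]
    calc _ ≤ (∫⁻ w, k v w) * φ v := by
          gcongr
          exact Measure.restrict_le_self
      _ = _ := by
          rw [hk, lintegral_weight p q hv, hφ, mul_right_comm, ← ENNReal.ofReal_mul (by positivity),
            mul_comm]
          congr 2
          rw [div_eq_mul_inv, mul_comm]
  rw [hcircle]
  calc _ ≤ ∫⁻ v in I, ∫⁻ w in I, ENNReal.ofReal (2 ^ q / (c ^ 3) ^ p) *
        (k v w * φ v + k v w * φ w) := by
        refine setLIntegral_mono' measurableSet_Ioc fun v hv => ?_
        rw [hcircle]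
        refine setLIntegral_mono' measurableSet_Ioc fun w hw => ?_
        rw [← mul_add, hk, hφ]
        exact apexKernel_le hp hq hc hγ h1 hbi x (hIabs v hv) (hIabs w hw)
    _ = ENNReal.ofReal (2 ^ q / (c ^ 3) ^ p) * ((∫⁻ v in I, ∫⁻ w in I, k v w * φ v) +
          ∫⁻ v in I, ∫⁻ w in I, k v w * φ w) := by
        rw [← lintegral_add_left hm1.lintegral_prod_right, ← lintegral_const_mul' _ _ (by simp)]
        refine lintegral_congr fun v => ?_
        have hmv : Measurable fun w => k v w * φ v := hm1.comp measurable_prodMk_left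
        rw [lintegral_const_mul' _ _ (by simp), lintegral_add_left hmv]
    _ ≤ _ := by
        rw [hswap, ← two_mul]
        gcongr

theorem lintegral_rpow_le_of_isProbabilityMeasure {α : Type*} [MeasurableSpace α] (μ : Measure α)
    [IsProbabilityMeasure μ] {q : ℝ} (hq : 1 ≤ q) {f : α → ℝ≥0∞} (hf : AEMeasurable f μ) :
    (∫⁻ a, f a ∂μ) ^ q ≤ ∫⁻ a, f a ^ q ∂μ := by
  have h := eLpNorm'_le_eLpNorm'_of_exponent_le (f := f) zero_lt_one hq μ hf.aestronglyMeasurable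
  have hq0 : 0 < q := by linarith
  simp only [eLpNorm', enorm_eq_self, ENNReal.rpow_one, div_one] at h
  calc (∫⁻ a, f a ∂μ) ^ q ≤ ((∫⁻ a, f a ^ q ∂μ) ^ (1 / q)) ^ q := by gcongr
    _ = _ := by rw [← ENNReal.rpow_mul, one_div_mul_cancel hq0.ne', ENNReal.rpow_one]

/-- A secant is the mean of the tangents along its arc; apply Jensen's inequality on the unit
interval. -/
theorem IsC1Curve.ofReal_secant_sub_le (hγ : IsC1Curve γ) {q : ℝ} (hq : 1 ≤ q) (x : UnitAddCircle)
    {v : ℝ} (hv : v ≠ 0) :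
    ENNReal.ofReal (‖secant γ x v - curveDeriv γ x‖ ^ q) ≤ ∫⁻ t in Ioo (0 : ℝ) 1,
      ENNReal.ofReal (‖curveDeriv γ (x + ((t * v : ℝ) : UnitAddCircle)) - curveDeriv γ x‖ ^ q) := by
  have hcoe : Continuous (fun x : ℝ => (x : UnitAddCircle)) := AddCircle.continuous_mk' 1
  have hc : Continuous fun t : ℝ => curveDeriv γ (x + ((t * v : ℝ) : UnitAddCircle)) := by
    have := hγ.continuous_curveDeriv
    have h2 : Continuous fun t : ℝ => ((t * v : ℝ) : UnitAddCircle) := hcoe.comp (by fun_prop)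
    fun_prop
  have hd : ∀ t : ℝ, HasDerivAt (fun t : ℝ => v⁻¹ • γ (x + ((t * v : ℝ) : UnitAddCircle)))
      (curveDeriv γ (x + ((t * v : ℝ) : UnitAddCircle))) t := by
    intro t
    have h2 := ((hγ.hasDerivAt x (t * v)).scomp t ((hasDerivAt_id t).mul_const v)).const_smul v⁻¹
    rw [one_mul, smul_smul, inv_mul_cancel₀ hv, one_smul] at h2
    exact h2
  have hsec : secant γ x v - curveDeriv γ x = ∫ t in Ioo (0 : ℝ) 1,
      (curveDeriv γ (x + ((t * v : ℝ) : UnitAddCircle)) - curveDeriv γ x) := by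
    have h2 := intervalIntegral.integral_eq_sub_of_hasDerivAt (a := 0) (b := 1) (fun t _ => hd t)
      (hc.intervalIntegrable 0 1)
    rw [zero_mul, one_mul, AddCircle.coe_zero, add_zero, ← smul_sub] at h2
    rw [secant, ← h2, ← integral_Ioc_eq_integral_Ioo, ← intervalIntegral.integral_of_le zero_le_one,
      intervalIntegral.integral_sub (hc.intervalIntegrable 0 1) (by simp)]
    simp
  have : IsProbabilityMeasure (volume.restrict (Ioo (0 : ℝ) 1)) := ⟨by simp⟩
  have hconv : ∀ a : EuclideanSpace ℝ (Fin n), ENNReal.ofReal (‖a‖ ^ q) = ‖a‖ₑ ^ q := by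
    intro a
    rw [← ENNReal.ofReal_rpow_of_nonneg (norm_nonneg a) (by linarith), ofReal_norm]
  simp_rw [hconv]
  rw [hsec]
  have hm : Continuous fun t : ℝ =>
      ‖curveDeriv γ (x + ((t * v : ℝ) : UnitAddCircle)) - curveDeriv γ x‖ₑ :=
    (hc.sub continuous_const).enorm
  refine le_trans ?_ (lintegral_rpow_le_of_isProbabilityMeasure _ hq hm.measurable.aemeasurable)
  gcongr
  exact enorm_integral_le_lintegral_enorm _

/-- After Jensen and Tonelli, rescaling `v` by `t` costs the factor `t^(κ-1)`, at most `1` for `t`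
in `(0, 1)`. -/
theorem lintegral_secant_sub_le {q κ : ℝ} (hq : 1 ≤ q) (hκ : 1 ≤ κ) (hγ : IsC1Curve γ) (δ : ℝ)
    (x : UnitAddCircle) :
    ∫⁻ v in Ioo (-δ) δ, ENNReal.ofReal (‖secant γ x v - curveDeriv γ x‖ ^ q / |v| ^ κ) ≤
      ∫⁻ v : ℝ in Ioo (-δ) δ,
        ENNReal.ofReal (‖curveDeriv γ (x + (v : UnitAddCircle)) - curveDeriv γ x‖ ^ q / |v| ^ κ) := by
  obtain ⟨ψ, hψ⟩ : ∃ ψ : ℝ → ℝ≥0∞, ψ = fun v : ℝ => ENNReal.ofReal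
    (‖curveDeriv γ (x + (v : UnitAddCircle)) - curveDeriv γ x‖ ^ q / |v| ^ κ) := ⟨_, rfl⟩
  have hcoe : Continuous (fun x : ℝ => (x : UnitAddCircle)) := AddCircle.continuous_mk' 1
  have hψm : Measurable ψ := by
    have h1 : Continuous fun v : ℝ =>
        ‖curveDeriv γ (x + (v : UnitAddCircle)) - curveDeriv γ x‖ := by
      have := hγ.continuous_curveDeriv
      fun_prop
    rw [hψ]
    exact ((h1.measurable.pow_const q).div
      (continuous_abs.measurable.pow_const κ)).ennreal_ofReal
  have hpt : ∀ v : ℝ, ENNReal.ofReal (‖secant γ x v - curveDeriv γ x‖ ^ q / |v| ^ κ) ≤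
      ∫⁻ t in Ioo (0 : ℝ) 1, ENNReal.ofReal (t ^ κ) * ψ (t * v) := by
    intro v
    rcases eq_or_ne v 0 with rfl | hv
    · simp [Real.zero_rpow (by linarith : κ ≠ 0)]
    have hv0 : 0 < |v| := abs_pos.2 hv
    rw [div_eq_mul_inv, ENNReal.ofReal_mul (by positivity)]
    refine (mul_le_mul_left (hγ.ofReal_secant_sub_le hq x hv) _).trans ?_
    rw [← lintegral_mul_const' _ _ (by simp)]
    refine setLIntegral_mono' measurableSet_Ioo fun t ht => ?_
    rw [hψ]
    dsimp only
    rw [← ENNReal.ofReal_mul (by positivity),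
      ← ENNReal.ofReal_mul (Real.rpow_nonneg ht.1.le _), abs_mul, abs_of_pos ht.1,
      Real.mul_rpow ht.1.le hv0.le]
    refine le_of_eq (congrArg _ ?_)
    have : 0 < t ^ κ := Real.rpow_pos_of_pos ht.1 _
    field_simp
  have hm : Measurable (Function.uncurry fun v t : ℝ => ENNReal.ofReal (t ^ κ) * ψ (t * v)) :=
    ((measurable_snd.pow_const κ).ennreal_ofReal).mul
      (hψm.comp (measurable_snd.mul measurable_fst))
  calc _ ≤ ∫⁻ v in Ioo (-δ) δ, ∫⁻ t in Ioo (0 : ℝ) 1, ENNReal.ofReal (t ^ κ) * ψ (t * v) :=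
        lintegral_mono hpt
    _ = ∫⁻ t in Ioo (0 : ℝ) 1, ∫⁻ v in Ioo (-δ) δ, ENNReal.ofReal (t ^ κ) * ψ (t * v) :=
        lintegral_lintegral_swap hm.aemeasurable
    _ ≤ ∫⁻ _ in Ioo (0 : ℝ) 1, ∫⁻ v in Ioo (-δ) δ, ψ v := by
        refine setLIntegral_mono' measurableSet_Ioo fun t ht => ?_
        rw [lintegral_const_mul' _ _ (by simp)]
        refine (mul_le_mul_right (setLIntegral_Ioo_comp_mul_le ht.1 ht.2.le ψ) _).trans ?_
        rw [← mul_assoc, ← ENNReal.ofReal_mul (Real.rpow_nonneg ht.1.le _)]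
        refine mul_le_of_le_one_left' (ENNReal.ofReal_le_one.2 ?_)
        rw [← div_eq_mul_inv, div_le_one ht.1]
        calc t ^ κ ≤ t ^ (1 : ℝ) := Real.rpow_le_rpow_of_exponent_ge ht.1 ht.2.le hκ
          _ = t := Real.rpow_one t
    _ = _ := by
        rw [hψ]
        simp

theorem mengerEnergy_lt_top_of_memSlobodeckij {p q : ℝ} (hq : 1 < q) (hp₁ : 2 / 3 * q + 1 < p)
    (hp₂ : p < q + 2 / 3) (hγ : IsC1Curve γ) (hinj : Function.Injective γ)
    (h1 : ∀ u, ‖curveDeriv γ u‖ = 1) (h : MemSlobodeckij ((3 * p - 2) / q - 1) q γ) :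
    mengerEnergy p q γ < ⊤ := by
  have hq0 : 0 < q := by linarith
  have hG := h.gagliardoLocal_lt_top hq0 hγ
  have hexp : 1 + q * ((3 * p - 2) / q - 1 - 1) = 3 * p - 2 * q - 1 := by
    field_simp
    ring
  rw [hexp] at hG
  obtain ⟨c, hc, hbi⟩ := hγ.exists_biLipschitz hinj h1
  have hle : ∀ x, ∫⁻ y, ∫⁻ z, apexKernel p q γ (x, y, z) ≤
      ENNReal.ofReal (2 ^ q / (c ^ 3) ^ p) * (2 * (weightConst p q *
        ∫⁻ v : ℝ in Ioo (-(1 / 2) : ℝ) (1 / 2), ENNReal.ofReal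
          (‖curveDeriv γ (x + (v : UnitAddCircle)) - curveDeriv γ x‖ ^ q /
            |v| ^ (3 * p - 2 * q - 1)))) := by
    intro x
    refine (lintegral_apexKernel_le (by linarith) hq0 hc hγ h1 hbi x).trans ?_
    refine mul_le_mul_right (mul_le_mul_right (mul_le_mul_right ?_ _) _) _
    exact lintegral_secant_sub_le hq.le (by linarith) hγ _ x
  have hWt := weightConst_ne_top hq hp₁ hp₂
  refine (mengerEnergy_le_apexKernel p q hγ.continuous h1).trans_lt ?_
  refine ENNReal.mul_lt_top (by simp) ((lintegral_mono hle).trans_lt ?_)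
  rw [lintegral_const_mul' _ _ (by simp), lintegral_const_mul' _ _ (by simp),
    lintegral_const_mul' _ _ hWt]
  exact ENNReal.mul_lt_top (by simp) (ENNReal.mul_lt_top (by simp)
    (ENNReal.mul_lt_top hWt.lt_top hG))

end Converse

end

theorem theorem1 (p q : ℝ) (hq : 1 < q) (hp₁ : 2 / 3 * q + 1 < p) (hp₂ : p < q + 2 / 3) :
    (∀ (n : ℕ) (γ : UnitAddCircle → EuclideanSpace ℝ (Fin n)),
      IsC1Curve γ → Function.Injective γ → (∀ u, ‖curveDeriv γ u‖ = 1) →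
        (mengerEnergy p q γ < ⊤ ↔ MemSlobodeckij ((3 * p - 2) / q - 1) q γ)) ∧
    ∃ C β : ℝ, 0 < C ∧ 0 < β ∧
      ∀ (n : ℕ) (γ : UnitAddCircle → EuclideanSpace ℝ (Fin n)),
        IsC1Curve γ → Function.Injective γ → (∀ u, ‖curveDeriv γ u‖ = 1) →
        mengerEnergy p q γ < ⊤ →
          ∀ u₀ : UnitAddCircle,
            slobodeckijNorm ((3 * p - 2) / q - 1) q (fun u => γ u - γ u₀) ≤
              ENNReal.ofReal C * (mengerEnergy p q γ + mengerEnergy p q γ ^ β) := by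
  refine ⟨fun n γ hγ hinj h1 => ⟨memSlobodeckij_of_energy hq hp₁ hγ h1,
    mengerEnergy_lt_top_of_memSlobodeckij hq hp₁ hp₂ hγ hinj h1⟩, ?_⟩
  obtain ⟨C, β, hC, hβ, h⟩ := exists_slobodeckijNorm_le hq hp₁
  exact ⟨C, β, hC, hβ, fun n γ hγ _ h1 hE u₀ => h n γ hγ h1 hE u₀⟩
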